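/- **Setting.** A finite-horizon linear MDP has measurable state and action spaces $\mathcal S,\mathcal A$, horizon $H\ge 1$, a fixed initial state $s_0$, a known measurable reward $r:\mathcal S\times\mathcal A\to[0,1]$, a known measurable feature map $\phi:\mathcal S\times\mathcal A\to\mathbb R^d$ ($d\ge1$) with $\|\phi(s,a)\|_2\le 1$, and an unknown transition density (with respect to a $\sigma$-finite base measure $\nu$ on $\mathcal S$) of the form $P(s'\mid s,a)=\langle \phi(s,a),\mu(s')\rangle$, where $\mu:\mathcal S\to\mathbb R^d$ is $\nu$-integrable and $\|\int v(s')\mu(s')\,d\nu(s')\|_2\le\sqrt d$ for every measurable $v$ with $|v|\le 1$. Let $\mathcal P$ be a finite class of such transition models (same $\phi$) containing the true one, $P^\star\in\mathcal P$, and let $\Pi$ be a class of (randomized, possibly time-dependent) Markov policies. For a policy $\pi$, let $d^\pi_h$ be the law of $(s_h,a_h)$ when $\pi$ is run under $P^\star$ from $s_0$, and let $d^\pi=\frac1H\sum_{h=0}^{H-1}d^\pi_h$. Let $J(\pi;f,P)$ be the expected total reward of $\pi$ over the horizon under transition model $P$ and reward $f$. **PC-MLP**, with parameters $N,M,K,c$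 and $\lambda=1$. Start from an arbitrary policy $\pi_1$. In episode $n=1,\dots,N$, conditionally on the past: 1. draw $K$ i.i.d. pairs $(s,a)\sim d^{\pi_n}$, let $\widehat\Sigma_{\pi_n}$ be the empirical mean of $\phi\phi^\top$ over them, and set $\widehat\Sigma_n=\sum_{i\le n}\widehat\Sigma_{\pi_i}+\lambda I$; 2. independently draw $M$ i.i.d. transitions with $(s,a)\sim\frac1n\sum_{i\le n}d^{\pi_i}$ and $s'\sim P^\star(\cdot\mid s,a)$, and let $\widehat P_n\in\mathcal P$ maximize $\sum\ln P(s'\mid s,a)$ over $P\in\mathcal P$, the sum being over these $M$ transitions; 3. set $\widehat b_n(s,a)=2\min\big\{c\sqrt{\tfrac12\phi(s,a)^\top\widehat\Sigma_n^{-1}\phi(s,a)},\,H\big\}$ and let $\pi_{n+1}$ be a maximizer of $J(\pi;r+\widehat b_n,\widehat P_n)$ over $\pi\in\Pi$ (assumed to exist and to be chosen measurably in the data). The returned policy $\hat\pi$ is the uniform mixture of $\pi_1,\dots,\pi_N$ (draw $i$ uniformly from $\{1,\dots,N\}$, then execute $\pi_i$), so $J(\hat\pi;r,P^\star)=\frac1N\sum_{n=1}^N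 J(\pi_n;r,P^\star)$. **Theorem (Sample Complexity for Linear MDPs).** Let $\delta\in(0,0.5)$ and $\epsilon\in(0,1)$, and set $$N=\Big\lceil\tfrac{80H^6d^2}{\epsilon^2}\ln\tfrac{40H^6d^2}{\epsilon^2}\Big\rceil,\quad M=\Big\lceil 2N\ln\tfrac{|\mathcal P|N}{\delta}\Big\rceil,\quad c=H\sqrt{d+1},\quad K=\Big\lceil 32N^2\ln\tfrac{8Nd}{\delta}\Big\rceil .$$ Then, with probability at least $1-2\delta$, PC-MLP returns a policy $\hat\pi$ with $$J(\hat\pi;r,P^\star)\ \ge\ \sup_{\pi\in\Pi}J(\pi;r,P^\star)-\epsilon ,$$ and on the same event some single iterate $\pi_i$, $1\le i\le N$, satisfies $J(\pi_i;r,P^\star)\ge\sup_{\pi\in\Pi}J(\pi;r,P^\star)-\epsilon$. The number of samples used is $$N(K+M)\ \le\ 60\cdot 80^3\cdot\frac{H^{18}d^6}{\epsilon^6}\cdot\ln\Big(\frac{640H^6d^2|\mathcal P|}{\epsilon^2\delta}\ln\frac{40H^6d^2}{\epsilon^2}\Big)\cdot\ln^3\Big(\frac{40H^6d^2}{\epsilon^2}\Big),$$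 that is, of order $H^{18}d^6/\epsilon^6$ up to factors logarithmic in $H,d,1/\epsilon,1/\delta,|\mathcal P|$. -/

import Mathlib

open MeasureTheory ProbabilityTheory
open scoped ENNReal Matrix

namespace PCMLP

/-- The known part of a finite-horizon linear MDP: horizon, fixed initial state, reward in `[0, 1]`,
feature map in the unit ball of `ℝ^d`, and a σ-finite base measure on the state space with respect
to which transition densities (and hence likelihoods) are taken. -/
structure Env (S A : Type*) [MeasurableSpace S] [MeasurableSpace A] (d : ℕ) where
  H : ℕ
  H_pos : 0 < H
  s₀ : S
  r : S × A → ℝ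
  r_measurable : Measurable r
  r_mem : ∀ x, r x ∈ Set.Icc (0 : ℝ) 1
  φ : S × A → EuclideanSpace ℝ (Fin d)
  φ_measurable : Measurable φ
  φ_norm : ∀ x, ‖φ x‖ ≤ 1
  base : Measure S
  base_sigmaFinite : SigmaFinite base

attribute [instance] Env.base_sigmaFinite

/-- A Markov, possibly randomized and time-dependent policy; only the steps `h < H` matter. -/
structure Policy (S A : Type*) [MeasurableSpace S] [MeasurableSpace A] where
  step : ℕ → Kernel S A
  markov : ∀ h, IsMarkovKernel (step h)

attribute [instance] Policy.markov

section Model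

variable {S A : Type*} [MeasurableSpace S] [MeasurableSpace A] {d : ℕ}

/-- A linear transition model `P(s' | s, a) = ⟪φ(s, a), μ(s')⟫` (a density with respect to
`E.base`), with `‖∫ v(s') μ(s') ds'‖ ≤ √d` whenever `|v| ≤ 1`. -/
structure LinearModel (E : Env S A d) where
  μ : S → EuclideanSpace ℝ (Fin d)
  μ_measurable : Measurable μ
  μ_integrable : Integrable μ E.base
  nonneg : ∀ x, ∀ᵐ s' ∂E.base, 0 ≤ inner ℝ (E.φ x) (μ s')
  lintegral_eq_one : ∀ x, ∫⁻ s', ENNReal.ofReal (inner ℝ (E.φ x) (μ s')) ∂E.base = 1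
  norm_le : ∀ v : S → ℝ, Measurable v → (∀ s, |v s| ≤ 1) →
    ‖∫ s, v s • μ s ∂E.base‖ ≤ √(d : ℝ)

/-- The transition density `P(s' | s, a)`. -/
noncomputable def LinearModel.density {E : Env S A d} (P : LinearModel E) (x : S × A) (s' : S) :
    ℝ≥0∞ :=
  ENNReal.ofReal (inner ℝ (E.φ x) (P.μ s'))

theorem LinearModel.measurable_density {E : Env S A d} (P : LinearModel E) :
    Measurable (Function.uncurry P.density) := by
  unfold LinearModel.density
  exact ((E.φ_measurable.comp measurable_fst).inner
    (P.μ_measurable.comp measurable_snd)).ennreal_ofReal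

/-- The transition kernel `P(· | s, a)`. -/
noncomputable def LinearModel.kernel {E : Env S A d} (P : LinearModel E) : Kernel (S × A) S :=
  Kernel.withDensity (Kernel.const (S × A) E.base) P.density

instance {E : Env S A d} (P : LinearModel E) : IsMarkovKernel P.kernel := by
  refine ⟨fun x => ⟨?_⟩⟩
  rw [LinearModel.kernel, Kernel.withDensity_apply _ P.measurable_density, Kernel.const_apply,
    withDensity_apply _ MeasurableSet.univ, Measure.restrict_univ]
  exact P.lintegral_eq_one x

/-- Law of the state at time `h` when `pol` is run from `s₀` under the transition kernel `P`. -/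
noncomputable def stateLaw (P : Kernel (S × A) S) (s₀ : S) (pol : Policy S A) : ℕ → Measure S
  | 0 => Measure.dirac s₀
  | h + 1 => (stateLaw P s₀ pol h ⊗ₘ pol.step h).bind P

/-- The state-action distribution `d_h^π`. -/
noncomputable def stepLaw (P : Kernel (S × A) S) (s₀ : S) (pol : Policy S A) (h : ℕ) :
    Measure (S × A) :=
  stateLaw P s₀ pol h ⊗ₘ pol.step h

/-- The averaged state-action distribution `d^π = (1/H) ∑_{h<H} d_h^π`. -/
noncomputable def visitLaw (E : Env S A d) (P : Kernel (S × A) S) (pol : Policy S A) :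
    Measure (S × A) :=
  (E.H : ℝ≥0∞)⁻¹ • ∑ h ∈ Finset.range E.H, stepLaw P E.s₀ pol h

/-- `J(π; f, P)`, the expected total reward of `pol` over the horizon, for reward `f` and
transition kernel `P`. -/
noncomputable def J (E : Env S A d) (pol : Policy S A) (f : S × A → ℝ) (P : Kernel (S × A) S) : ℝ :=
  ∑ h ∈ Finset.range E.H, ∫ x, f x ∂stepLaw P E.s₀ pol h

/-- Hyper-parameters: number of episodes `N`, number `K` of covariance samples and number `M` of
model-learning samples per episode, bonus scale `c` and ridge parameter `lam`. -/
structure HyperParams where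
  N : ℕ
  K : ℕ
  M : ℕ
  c : ℝ
  lam : ℝ

/-- Number of samples used in `N` episodes, each of which draws `K + M` samples. -/
def HyperParams.numSamples (p : HyperParams) : ℕ := p.N * (p.K + p.M)

/-- The data of one episode: `K` state-action pairs (for the covariance estimate) and
`M` transitions `((s, a), s')` (for model learning). -/
abbrev Batch (S A : Type*) (p : HyperParams) : Type _ :=
  (Fin p.K → S × A) × (Fin p.M → (S × A) × S)

/-- The log-likelihood `∑ ln P(s'_i | s_i, a_i)`, with `ln 0 = -∞`. -/
noncomputable def logLik {E : Env S A d} {p : HyperParams} (P : LinearModel E) (b : Batch S A p) :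
    EReal :=
  ∑ i, ENNReal.log (P.density (b.2 i).1 (b.2 i).2)

/-- `Σ̂_n = ∑_{i ≤ n} (1/K) ∑_j φ_{ij} φ_{ij}ᵀ + λ I`, over all episodes recorded in `hist`. -/
noncomputable def empCov (E : Env S A d) (p : HyperParams) {n : ℕ} (hist : Fin n → Batch S A p) :
    Matrix (Fin d) (Fin d) ℝ :=
  (∑ i, (p.K : ℝ)⁻¹ • ∑ j, Matrix.vecMulVec (E.φ ((hist i).1 j)).ofLp (E.φ ((hist i).1 j)).ofLp)
    + p.lam • (1 : Matrix (Fin d) (Fin d) ℝ)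

/-- The reward bonus `b̂_n(s, a) = 2 min {c √(½ φ(s,a)ᵀ Σ̂_n⁻¹ φ(s,a)), H}`. -/
noncomputable def bonus (E : Env S A d) (p : HyperParams) {n : ℕ} (hist : Fin n → Batch S A p)
    (x : S × A) : ℝ :=
  2 * min (p.c * √((1 / 2) * ((E.φ x).ofLp ⬝ᵥ ((empCov E p hist)⁻¹ *ᵥ (E.φ x).ofLp)))) (E.H : ℝ)

/-- The first `i` episodes of a history of length `n`. -/
def prefixHist {p : HyperParams} {n i : ℕ} (hi : i ≤ n) (hist : Fin n → Batch S A p) :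
    Fin i → Batch S A p :=
  fun j => hist (Fin.castLE hi j)

/-- The policy obtained from a history-dependent one by fixing the history. -/
noncomputable def sectPolicy {Γ : Type*} [MeasurableSpace Γ]
    (κ : ℕ → Kernel (Γ × S) A) [∀ h, IsMarkovKernel (κ h)] (γ : Γ) :
    Policy S A where
  step h := (κ h).sectR γ
  markov _ := inferInstance

/-- An instance of the algorithm PC-MLP with model class `Mods` and policy class `Pol`, i.e. a choice
of the initial policy, of the maximum-likelihood models and of the planned policies. Episodes are
numbered `0, 1, …, N - 1`.

* `act n` is the policy executed in episode `n`, as a (measurable) function of the data of the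
  episodes before `n`; `act 0` is an arbitrary initial policy.
* `mle n` is the model fitted at the end of episode `n`: a maximum-likelihood model in `Mods` for the
  `M` transitions of that episode.
* The policy of episode `n + 1` maximizes `J(·; r + b̂_n, P̂_n)` over `Pol`. -/
structure Alg (E : Env S A d) (Mods : Finset (LinearModel E)) (Pol : Set (Policy S A))
    (p : HyperParams) where
  act : ∀ n : ℕ, ℕ → Kernel ((Fin n → Batch S A p) × S) A
  act_markov : ∀ n h, IsMarkovKernel (act n h)
  mle : ∀ n : ℕ, (Fin (n + 1) → Batch S A p) → LinearModel E
  mle_mem : ∀ n < p.N, ∀ hist, mle n hist ∈ Mods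
  mle_max : ∀ n < p.N, ∀ hist, ∀ Q ∈ Mods,
    logLik Q (hist (Fin.last n)) ≤ logLik (mle n hist) (hist (Fin.last n))
  plan_mem : ∀ n < p.N, ∀ hist,
    sectPolicy (act (n + 1)) hist ∈ Pol
  plan_max : ∀ n < p.N, ∀ hist, ∀ pol ∈ Pol,
    J E pol (fun x => E.r x + bonus E p hist x) (mle n hist).kernel ≤
      J E (sectPolicy (act (n + 1)) hist)
        (fun x => E.r x + bonus E p hist x) (mle n hist).kernel

attribute [instance] Alg.act_markov

/-! ### Measurability of history-dependent roll-outs -/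

section Measurability

variable {Γ : Type*} [MeasurableSpace Γ]

instance stateLaw_prob (P : Kernel (S × A) S) [IsMarkovKernel P] (s₀ : S) (pol : Policy S A)
    (h : ℕ) : IsProbabilityMeasure (stateLaw P s₀ pol h) := by
  induction h with
  | zero => unfold stateLaw; infer_instance
  | succ h ih => unfold stateLaw; infer_instance

instance stepLaw_prob (P : Kernel (S × A) S) [IsMarkovKernel P] (s₀ : S) (pol : Policy S A)
    (h : ℕ) : IsProbabilityMeasure (stepLaw P s₀ pol h) := by
  unfold stepLaw; infer_instance

instance visitLaw_prob (E : Env S A d) (P : Kernel (S × A) S) [IsMarkovKernel P]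
    (pol : Policy S A) : IsProbabilityMeasure (visitLaw E P pol) := by
  refine ⟨?_⟩
  have h0 : (E.H : ℝ≥0∞) ≠ 0 := by exact_mod_cast E.H_pos.ne'
  simp [visitLaw, ENNReal.inv_mul_cancel h0 (ENNReal.natCast_ne_top _)]

theorem measurable_stateLaw_sect (P : Kernel (S × A) S) [IsMarkovKernel P] (s₀ : S)
    (κ : ℕ → Kernel (Γ × S) A) [∀ h, IsMarkovKernel (κ h)] (h : ℕ) :
    Measurable fun γ => stateLaw P s₀ (sectPolicy κ γ) h := by
  induction h with
  | zero => exact measurable_const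
  | succ h ih =>
    let η : Kernel Γ S := ⟨_, ih⟩
    have : IsMarkovKernel η := ⟨fun γ => stateLaw_prob P s₀ _ h⟩
    have : (fun γ => stateLaw P s₀ (sectPolicy κ γ) (h + 1)) = P ∘ₖ (η ⊗ₖ κ h) := by
      funext γ
      rw [Kernel.comp_apply, Kernel.compProd_apply_eq_compProd_sectR]
      rfl
    rw [this]
    exact Kernel.measurable _

theorem measurable_stepLaw_sect (P : Kernel (S × A) S) [IsMarkovKernel P] (s₀ : S)
    (κ : ℕ → Kernel (Γ × S) A) [∀ h, IsMarkovKernel (κ h)] (h : ℕ) :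
    Measurable fun γ => stepLaw P s₀ (sectPolicy κ γ) h := by
  let η : Kernel Γ S := ⟨_, measurable_stateLaw_sect P s₀ κ h⟩
  have : IsMarkovKernel η := ⟨fun γ => stateLaw_prob P s₀ _ h⟩
  have : (fun γ => stepLaw P s₀ (sectPolicy κ γ) h) = (η ⊗ₖ κ h) := by
    funext γ
    rw [Kernel.compProd_apply_eq_compProd_sectR]
    rfl
  rw [this]
  exact Kernel.measurable _

theorem measurable_visitLaw_sect (E : Env S A d) (P : Kernel (S × A) S) [IsMarkovKernel P]
    (κ : ℕ → Kernel (Γ × S) A) [∀ h, IsMarkovKernel (κ h)] :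
    Measurable fun γ => visitLaw E P (sectPolicy κ γ) := by
  refine Measure.measurable_of_measurable_coe _ fun s hs => ?_
  simp only [visitLaw, Measure.smul_apply, Measure.finsetSum_apply, smul_eq_mul]
  refine Measurable.const_mul (Finset.measurable_sum _ fun h _ => ?_) _
  exact (Measure.measurable_coe hs).comp (measurable_stepLaw_sect P E.s₀ κ h)

theorem measurable_pi_law {X : Type*} [MeasurableSpace X] (m : ℕ) {ρ : Γ → Measure X}
    (hρ : Measurable ρ) [∀ γ, IsProbabilityMeasure (ρ γ)] :
    Measurable fun γ => Measure.pi fun _ : Fin m => ρ γ := by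
  refine Measurable.measure_of_isPiSystem_of_isProbabilityMeasure generateFrom_pi.symm isPiSystem_pi
    ?_
  rintro _ ⟨t, ht, rfl⟩
  simp only [Measure.pi_pi]
  refine Finset.measurable_prod _ fun i _ => ?_
  exact (Measure.measurable_coe (ht i (Set.mem_univ i))).comp hρ

end Measurability

/-! ### Law of a run -/

namespace Alg

variable {E : Env S A d} {Mods : Finset (LinearModel E)} {Pol : Set (Policy S A)} {p : HyperParams}

/-- The policy executed in episode `n`, given the data of the episodes before `n`. -/
noncomputable def policy (alg : Alg E Mods Pol p) (n : ℕ) (hist : Fin n → Batch S A p) :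
    Policy S A :=
  sectPolicy (alg.act n) hist

/-- The distribution `(1/(n+1)) ∑_{i ≤ n} d^{π_i}` of the policy cover in episode `n`. -/
noncomputable def coverLaw (alg : Alg E Mods Pol p) (P : LinearModel E) (n : ℕ)
    (hist : Fin n → Batch S A p) : Measure (S × A) :=
  ((n + 1 : ℕ) : ℝ≥0∞)⁻¹ • ∑ i : Fin (n + 1),
    visitLaw E P.kernel (alg.policy i (prefixHist (Nat.lt_succ_iff.mp i.2) hist))

/-- Conditional law, given the past, of the data of episode `n` when the true model is `P`:
`K` i.i.d. draws from `d^{π_n}` and, independently, `M` i.i.d. transitions with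
`(s, a)` drawn from the policy cover and `s' ∼ P(· | s, a)`. -/
noncomputable def batchLaw (alg : Alg E Mods Pol p) (P : LinearModel E) (n : ℕ)
    (hist : Fin n → Batch S A p) : Measure (Batch S A p) :=
  (Measure.pi fun _ : Fin p.K => visitLaw E P.kernel (alg.policy n hist)).prod
    (Measure.pi fun _ : Fin p.M => alg.coverLaw P n hist ⊗ₘ P.kernel)

instance (alg : Alg E Mods Pol p) (P : LinearModel E) (n : ℕ) (hist : Fin n → Batch S A p) :
    IsProbabilityMeasure (alg.coverLaw P n hist) := by
  refine ⟨?_⟩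
  have h0 : ((n + 1 : ℕ) : ℝ≥0∞) ≠ 0 := by exact_mod_cast n.succ_ne_zero
  have h1 := ENNReal.inv_mul_cancel h0 (ENNReal.natCast_ne_top _)
  simpa [coverLaw] using h1

theorem measurable_coverLaw (alg : Alg E Mods Pol p) (P : LinearModel E) (n : ℕ) :
    Measurable (alg.coverLaw P n) := by
  refine Measure.measurable_of_measurable_coe _ fun s hs => ?_
  simp only [coverLaw, Measure.smul_apply, Measure.finsetSum_apply, smul_eq_mul]
  refine Measurable.const_mul (Finset.measurable_sum _ fun i _ => ?_) _
  refine (Measure.measurable_coe hs).comp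
    ((measurable_visitLaw_sect E P.kernel (alg.act i)).comp ?_)
  exact measurable_pi_lambda _ fun j => measurable_pi_apply _

theorem measurable_batchLaw (alg : Alg E Mods Pol p) (P : LinearModel E) (n : ℕ) :
    Measurable (alg.batchLaw P n) := by
  let κ : Kernel (Fin n → Batch S A p) (S × A) := ⟨_, alg.measurable_coverLaw P n⟩
  have : IsMarkovKernel κ := ⟨fun hist => by
    change IsProbabilityMeasure (alg.coverLaw P n hist); infer_instance⟩
  have hM : Measurable fun hist => alg.coverLaw P n hist ⊗ₘ P.kernel := by
    have : (fun hist => alg.coverLaw P n hist ⊗ₘ P.kernel)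
        = (κ ⊗ₖ Kernel.prodMkLeft (Fin n → Batch S A p) P.kernel) := by
      funext hist
      rw [Kernel.compProd_apply_eq_compProd_sectR, Kernel.sectR_prodMkLeft]
      rfl
    rw [this]
    exact Kernel.measurable _
  let κ₁ : Kernel (Fin n → Batch S A p) (Fin p.K → S × A) :=
    ⟨_, measurable_pi_law p.K (measurable_visitLaw_sect E P.kernel (alg.act n))⟩
  let κ₂ : Kernel (Fin n → Batch S A p) (Fin p.M → (S × A) × S) :=
    ⟨_, measurable_pi_law p.M hM⟩
  have : IsMarkovKernel κ₁ := ⟨fun hist => by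
    change IsProbabilityMeasure (Measure.pi _); infer_instance⟩
  have : IsMarkovKernel κ₂ := ⟨fun hist => by
    change IsProbabilityMeasure (Measure.pi _); infer_instance⟩
  have : alg.batchLaw P n = (κ₁ ×ₖ κ₂) := by
    funext hist
    rw [Kernel.prod_apply]
    rfl
  rw [this]
  exact Kernel.measurable _

/-- `batchLaw` as a Markov kernel from the past data to the data of episode `n`. -/
noncomputable def batchKernel (alg : Alg E Mods Pol p) (P : LinearModel E) (n : ℕ) :
    Kernel (Fin n → Batch S A p) (Batch S A p) :=
  ⟨alg.batchLaw P n, alg.measurable_batchLaw P n⟩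

instance (alg : Alg E Mods Pol p) (P : LinearModel E) (n : ℕ) :
    IsMarkovKernel (alg.batchKernel P n) := ⟨fun hist => by
  change IsProbabilityMeasure (alg.batchLaw P n hist)
  unfold batchLaw visitLaw
  change IsProbabilityMeasure ((Measure.pi fun _ : Fin p.K =>
    visitLaw E P.kernel (alg.policy n hist)).prod _)
  infer_instance⟩

/-- Law of the data of the first `n` episodes of a run when the true model is `P`. -/
noncomputable def runLaw (alg : Alg E Mods Pol p) (P : LinearModel E) :
    (n : ℕ) → Measure (Fin n → Batch S A p)
  | 0 => Measure.dirac Fin.elim0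
  | n + 1 => (runLaw alg P n ⊗ₘ alg.batchKernel P n).map
      fun q => Fin.snoc (α := fun _ => Batch S A p) q.1 q.2

theorem measurable_snoc (n : ℕ) : Measurable fun q : (Fin n → Batch S A p) × Batch S A p =>
    (Fin.snoc (α := fun _ => Batch S A p) q.1 q.2 : Fin (n + 1) → Batch S A p) := by
  refine measurable_pi_lambda _ fun i => ?_
  refine Fin.lastCases ?_ (fun j => ?_) i
  · simpa using measurable_snd
  · simp only [Fin.snoc_castSucc]
    exact (measurable_pi_apply j).comp measurable_fst

instance (alg : Alg E Mods Pol p) (P : LinearModel E) (n : ℕ) :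
    IsProbabilityMeasure (alg.runLaw P n) := by
  induction n with
  | zero => unfold runLaw; infer_instance
  | succ n ih =>
    unfold runLaw
    exact Measure.isProbabilityMeasure_map (measurable_snoc n).aemeasurable

/-- The policy of episode `i < N` in a completed run. -/
noncomputable def iterate (alg : Alg E Mods Pol p) (hist : Fin p.N → Batch S A p) (i : Fin p.N) :
    Policy S A :=
  alg.policy i (prefixHist i.2.le hist)

/-- True value of the returned policy `π̂`, the uniform mixture of the policies of the `N` episodes
(draw an episode uniformly at random, then execute its policy). -/
noncomputable def returnValue (alg : Alg E Mods Pol p) (P : LinearModel E)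
    (hist : Fin p.N → Batch S A p) : ℝ :=
  (p.N : ℝ)⁻¹ * ∑ i, J E (alg.iterate hist i) E.r P.kernel

end Alg

end Model

end PCMLP

/-! The proof bounds the regret of the iterates on one good event and then divides by `N`. Three
facts carry it.

Likelihood. For a fixed model `Q`, the product of the square roots of the likelihood ratios `Q / P⋆`
over the `M` transitions has mean equal to the `M`-th power of the average Bhattacharyya affinity.
Markov's inequality and a union bound over the finite class show that, with high probability, no
model whose average affinity deficit on the policy cover is at least `1/(2N)` is as likely as `P⋆`
(`measure_prod_density_le`). The fitted models are therefore accurate on the cover.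

Covariance. The matrices `φ φᵀ` are vectors of norm at most 1 in a Hilbert space, so a
dimension-free Hoeffding inequality (`measureReal_norm_sum_ge_le`) keeps the quadratic form of the
empirical covariance within `½ ‖v‖²` of the population one.

Linearity. The error of a model on a function with values in `[0, B]` is `⟪φ(x), θ⟫` with `‖θ‖ ≤ B
√d` (`exists_modelError`). Cauchy–Schwarz in the norm of the population covariance `Σ_n` bounds it
by `B g_n(x)`, where `g_n = min {√(d+1) ‖φ‖_{Σ_n⁻¹}, 1}` is `width` (`abs_modelError_le_width`).

On the good event the bonus lies between `H g_n` and `2 H g_n`. The lower bound makes the planned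
value optimistic; the upper bound and the simulation lemma then bound the suboptimality of the next
policy by `3 H³` times the mean of `g_n` under that policy's own visitation law
(`J_sub_J_le_integral_width`). The elliptic potential lemma (`sum_trace_inv_mul_le`) sums these
means to order `d √(N log N)`, and `N` is chosen so that the average regret is at most `ε`. The best
iterate is at least as good as the average. -/

namespace PCMLP

/-! ### Positive definite forms, determinants and the elliptic potential lemma. -/

section LinearAlgebra

variable {n : Type*} [Fintype n]

theorem dotProduct_mulVec_symm {T : Matrix n n ℝ} (h : T.IsHermitian) (v w : n → ℝ) :
    v ⬝ᵥ (T *ᵥ w) = w ⬝ᵥ (T *ᵥ v) := by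
  have ht : Tᵀ = T := by
    simpa [Matrix.IsHermitian, Matrix.conjTranspose_eq_transpose_of_trivial] using h
  rw [Matrix.dotProduct_mulVec, ← Matrix.mulVec_transpose, ht, dotProduct_comm]

theorem posSemidef_quadForm_nonneg {T : Matrix n n ℝ} (h : T.PosSemidef) (v : n → ℝ) :
    0 ≤ v ⬝ᵥ (T *ᵥ v) := by
  simpa using h.dotProduct_mulVec_nonneg v

/-- Cauchy–Schwarz for a positive semidefinite form. -/
theorem sq_dotProduct_mulVec_le {T : Matrix n n ℝ} (h : T.PosSemidef) (v w : n → ℝ) :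
    (v ⬝ᵥ (T *ᵥ w)) ^ 2 ≤ (v ⬝ᵥ (T *ᵥ v)) * (w ⬝ᵥ (T *ᵥ w)) := by
  have key : ∀ t : ℝ, 0 ≤ (v ⬝ᵥ (T *ᵥ v)) * (t * t) + (2 * (v ⬝ᵥ (T *ᵥ w))) * t
      + w ⬝ᵥ (T *ᵥ w) := by
    intro t
    have h0 := posSemidef_quadForm_nonneg h (t • v + w)
    have h1 := dotProduct_mulVec_symm h.isHermitian w v
    simp only [Matrix.mulVec_add, Matrix.mulVec_smul, add_dotProduct, dotProduct_add,
      smul_dotProduct, dotProduct_smul, smul_eq_mul, h1] at h0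
    linarith
  have := discrim_le_zero key
  unfold discrim at this
  linarith

variable [DecidableEq n]

theorem mulVec_inv_mulVec {T : Matrix n n ℝ} (h : T.PosDef) (v : n → ℝ) :
    T *ᵥ (T⁻¹ *ᵥ v) = v := by
  rw [Matrix.mulVec_mulVec, Matrix.mul_nonsing_inv _ ((Matrix.isUnit_iff_isUnit_det _).1 h.isUnit),
    Matrix.one_mulVec]

theorem sq_dotProduct_le_of_posDef {T : Matrix n n ℝ} (h : T.PosDef) (v w : n → ℝ) :
    (v ⬝ᵥ w) ^ 2 ≤ (v ⬝ᵥ (T⁻¹ *ᵥ v)) * (w ⬝ᵥ (T *ᵥ w)) := by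
  have h1 := sq_dotProduct_mulVec_le h.posSemidef w (T⁻¹ *ᵥ v)
  rw [mulVec_inv_mulVec h, dotProduct_comm w v, dotProduct_comm (T⁻¹ *ᵥ v) v] at h1
  linarith

/-- Inversion reverses the order. With `w = U⁻¹ v` and `q = v · U⁻¹ v`, Cauchy–Schwarz gives `q² ≤
(v · T⁻¹ v)(w · T w)`, the hypothesis gives `w · T w ≤ 2 q`, and one factor `q` cancels. -/
theorem inv_quadForm_le {T U : Matrix n n ℝ} (hT : T.PosDef) (hU : U.PosDef)
    (h : ∀ v, v ⬝ᵥ (T *ᵥ v) ≤ 2 * (v ⬝ᵥ (U *ᵥ v))) (v : n → ℝ) :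
    v ⬝ᵥ (U⁻¹ *ᵥ v) ≤ 2 * (v ⬝ᵥ (T⁻¹ *ᵥ v)) := by
  have h1 := sq_dotProduct_le_of_posDef hT v (U⁻¹ *ᵥ v)
  have h2 := h (U⁻¹ *ᵥ v)
  rw [mulVec_inv_mulVec hU, dotProduct_comm (U⁻¹ *ᵥ v) v] at h2
  have h3 := posSemidef_quadForm_nonneg hT.inv.posSemidef v
  rcases (posSemidef_quadForm_nonneg hU.inv.posSemidef v).eq_or_lt with h4 | h4
  · rw [← h4]; positivity
  · refine le_of_mul_le_mul_right ?_ h4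
    nlinarith [mul_le_mul_of_nonneg_left h2 h3]

theorem one_add_sum_le_prod {ι : Type*} (s : Finset ι) (f : ι → ℝ) (hf : ∀ i, 0 ≤ f i) :
    1 + ∑ i ∈ s, f i ≤ ∏ i ∈ s, (1 + f i) := by
  classical
  induction s using Finset.induction_on with
  | empty => simp
  | insert i s hi ih =>
    rw [Finset.sum_insert hi, Finset.prod_insert hi]
    nlinarith [hf i, Finset.sum_nonneg fun j (_ : j ∈ s) => hf j,
      mul_le_mul_of_nonneg_left ih (hf i),
      mul_nonneg (hf i) (Finset.sum_nonneg fun j (_ : j ∈ s) => hf j)]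

theorem one_add_trace_le_det {T : Matrix n n ℝ} (h : T.PosSemidef) :
    1 + T.trace ≤ (1 + T).det := by
  have h1 : (1 + T).det = ∏ i, (1 + h.1.eigenvalues i) := by
    -- At `-1` the characteristic polynomial is `det (-(1 + T))`; both sides carry the same power of
    -- `-1`, which is cancelled at the end.
    have := congrArg (Polynomial.eval (-1 : ℝ)) h.1.charpoly_eq
    rw [Matrix.eval_charpoly, Polynomial.eval_prod] at this
    have e1 : Matrix.scalar n (-1 : ℝ) - T = -(1 + T) := by
      rw [map_neg, map_one]; abel
    have e2 : ∀ i, Polynomial.eval (-1 : ℝ)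
        (Polynomial.X - Polynomial.C ((h.1.eigenvalues i : ℝ))) =
        (-1) * (1 + h.1.eigenvalues i) := by
      intro i; simp; ring
    simp only [RCLike.ofReal_real_eq_id, id_eq] at this
    rw [e1, Matrix.det_neg] at this
    simp_rw [e2] at this
    rw [Finset.prod_mul_distrib, Finset.prod_const, Finset.card_univ] at this
    exact mul_left_cancel₀ (by positivity) this
  rw [h1, h.1.trace_eq_sum_eigenvalues]
  simpa using one_add_sum_le_prod Finset.univ h.1.eigenvalues h.eigenvalues_nonneg

/-- Writing `T = Bᴴ B` turns `T + G` into `Bᴴ (1 + B⁻ᴴ G B⁻¹) B`, which reduces the claim to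
`one_add_trace_le_det`; the traces agree by cyclicity. No rank assumption on `G` is needed, so
averaged updates `∫ φ φᵀ` are covered. -/
theorem det_add_ge {T G : Matrix n n ℝ} (hT : T.PosDef) (hG : G.PosSemidef) :
    T.det * (1 + (T⁻¹ * G).trace) ≤ (T + G).det := by
  obtain ⟨B, hB⟩ : ∃ B : Matrix n n ℝ, T = Bᴴ * B := by
    open scoped MatrixOrder in
    exact CStarAlgebra.nonneg_iff_eq_star_mul_self.1
      (Matrix.nonneg_iff_posSemidef.2 hT.posSemidef)
  have hdet : T.det = B.det * B.det := by
    rw [hB, Matrix.det_mul, Matrix.det_conjTranspose]; simp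
  have hu : IsUnit B.det := by
    have := hT.det_pos
    rw [isUnit_iff_ne_zero]
    rintro h0
    rw [hdet, h0] at this
    simp at this
  have hS := hG.conjTranspose_mul_mul_same B⁻¹
  have h1 := one_add_trace_le_det hS
  have hu' : IsUnit Bᴴ.det := by rw [Matrix.det_conjTranspose]; exact hu.star
  have hBB : Bᴴ * (B⁻¹)ᴴ = 1 := by
    rw [← Matrix.conjTranspose_mul, Matrix.nonsing_inv_mul _ hu, Matrix.conjTranspose_one]
  have h2 : T + G = Bᴴ * (1 + (B⁻¹)ᴴ * G * B⁻¹) * B := by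
    rw [mul_add, add_mul, mul_one, ← hB]
    congr 1
    calc G = (Bᴴ * (B⁻¹)ᴴ) * G * (B⁻¹ * B) := by
          rw [hBB, Matrix.nonsing_inv_mul _ hu, one_mul, mul_one]
      _ = _ := by simp only [mul_assoc]
  have h3 : (T⁻¹ * G).trace = ((B⁻¹)ᴴ * G * B⁻¹).trace := by
    rw [hB, Matrix.mul_inv_rev, Matrix.conjTranspose_nonsing_inv, mul_assoc, Matrix.trace_mul_comm]
  have h4 : (T + G).det = T.det * (1 + (B⁻¹)ᴴ * G * B⁻¹).det := by
    rw [h2, Matrix.det_mul, Matrix.det_mul, Matrix.det_conjTranspose, hdet]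
    simp only [star_trivial]
    ring
  rw [h3, h4]
  exact mul_le_mul_of_nonneg_left h1 hT.det_pos.le

/-- On `[0, 1]` one has `log (1 + t) ≥ t / (1 + t) ≥ t / 2`. -/
theorem half_trace_le_log_det_sub {T G : Matrix n n ℝ} (hT : T.PosDef) (hG : G.PosSemidef)
    (h0 : 0 ≤ (T⁻¹ * G).trace) (h1 : (T⁻¹ * G).trace ≤ 1) :
    (T⁻¹ * G).trace / 2 ≤ Real.log (T + G).det - Real.log T.det := by
  set t := (T⁻¹ * G).trace
  have h2 : Real.log (T.det * (1 + t)) ≤ Real.log (T + G).det :=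
    Real.log_le_log (mul_pos hT.det_pos (by linarith)) (det_add_ge hT hG)
  rw [Real.log_mul hT.det_pos.ne' (by linarith)] at h2
  have h3 := Real.one_sub_inv_le_log_of_pos (show 0 < 1 + t by linarith)
  have h4 : t / 2 ≤ 1 - (1 + t)⁻¹ := by
    rw [show 1 - (1 + t)⁻¹ = t / (1 + t) by field_simp; ring]
    exact div_le_div_of_nonneg_left h0 (by linarith) (by linarith)
  linarith

/-- Each eigenvalue is the value of the form at a unit eigenvector, hence at most `c`. -/
theorem det_le_pow {T : Matrix n n ℝ} (hT : T.PosDef) {c : ℝ}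
    (h : ∀ v, v ⬝ᵥ (T *ᵥ v) ≤ c * (v ⬝ᵥ v)) : T.det ≤ c ^ Fintype.card n := by
  rw [hT.1.det_eq_prod_eigenvalues, ← Finset.card_univ]
  rw [← Finset.prod_const]
  refine Finset.prod_le_prod (fun i _ => hT.posSemidef.eigenvalues_nonneg i) fun i _ => ?_
  have h1 := h (hT.1.eigenvectorBasis i)
  have h2 : (hT.1.eigenvectorBasis i).ofLp ⬝ᵥ (hT.1.eigenvectorBasis i).ofLp = 1 := by
    have := EuclideanSpace.inner_eq_star_dotProduct (hT.1.eigenvectorBasis i)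
      (hT.1.eigenvectorBasis i)
    rw [real_inner_self_eq_norm_sq, hT.1.eigenvectorBasis.orthonormal.1 i] at this
    simpa using this.symm
  rw [h2, mul_one] at h1
  rw [hT.1.eigenvalues_eq]
  simpa using h1

/-- The elliptic potential lemma. -/
theorem sum_trace_inv_mul_le {T G : ℕ → Matrix n n ℝ} (hT : ∀ k, (T k).PosDef)
    (hG : ∀ k, (G k).PosSemidef) (hTG : ∀ k, T (k + 1) = T k + G k)
    (h0 : ∀ k, 0 ≤ ((T k)⁻¹ * G k).trace) (h1 : ∀ k, ((T k)⁻¹ * G k).trace ≤ 1)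
    (hdet : 1 ≤ (T 0).det) {c : ℝ} (m : ℕ) (hc : ∀ v, v ⬝ᵥ (T m *ᵥ v) ≤ c * (v ⬝ᵥ v)) :
    ∑ k ∈ Finset.range m, ((T k)⁻¹ * G k).trace ≤ 2 * (Fintype.card n * Real.log c) := by
  -- Each trace is at most twice the increment of `log det`, and the increments telescope.
  have h2 : ∀ m : ℕ, ∑ k ∈ Finset.range m, ((T k)⁻¹ * G k).trace ≤
      2 * (Real.log (T m).det - Real.log (T 0).det) := by
    intro m
    induction m with
    | zero => simp
    | succ m ih =>
      have := half_trace_le_log_det_sub (hT m) (hG m) (h0 m) (h1 m)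
      rw [Finset.sum_range_succ, hTG m]
      linarith
  have h3 := Real.log_le_log (hT m).det_pos (det_le_pow (hT m) hc)
  rw [Real.log_pow] at h3
  linarith [h2 m, Real.log_nonneg hdet]

end LinearAlgebra

/-! ### Second-moment matrices of bounded features. -/

section SecondMoment

variable {X : Type*} {d : ℕ}

theorem dotProduct_self_eq_norm_sq (v : EuclideanSpace ℝ (Fin d)) :
    v.ofLp ⬝ᵥ v.ofLp = ‖v‖ ^ 2 := by
  rw [← real_inner_self_eq_norm_sq, EuclideanSpace.inner_eq_star_dotProduct, star_trivial]

theorem dotProduct_eq_inner (v w : EuclideanSpace ℝ (Fin d)) :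
    v.ofLp ⬝ᵥ w.ofLp = inner ℝ v w := by
  rw [EuclideanSpace.inner_eq_star_dotProduct, star_trivial, dotProduct_comm]

theorem sq_dotProduct_le {φ : X → EuclideanSpace ℝ (Fin d)}
    (h : ∀ x, ‖φ x‖ ≤ 1) (x : X) (v : Fin d → ℝ) :
    ((φ x).ofLp ⬝ᵥ v) ^ 2 ≤ v ⬝ᵥ v := by
  have h1 := abs_real_inner_le_norm (φ x) (WithLp.toLp 2 v)
  rw [← dotProduct_eq_inner] at h1
  have h2 : v ⬝ᵥ v = ‖WithLp.toLp 2 v‖ ^ 2 := dotProduct_self_eq_norm_sq (WithLp.toLp 2 v)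
  rw [h2]
  refine sq_le_sq' ?_ ?_
  · nlinarith [abs_le.1 h1, h x, norm_nonneg (WithLp.toLp 2 v)]
  · nlinarith [abs_le.1 h1, h x, norm_nonneg (WithLp.toLp 2 v)]

theorem abs_coord_le_one {φ : X → EuclideanSpace ℝ (Fin d)} (h : ∀ x, ‖φ x‖ ≤ 1)
    (x : X) (i : Fin d) : |φ x i| ≤ 1 := by
  simpa using (PiLp.norm_apply_le (φ x) i).trans (h x)

variable [MeasurableSpace X]

/-- The matrix `∫ φ φᵀ dρ`. -/
noncomputable def secondMoment (φ : X → EuclideanSpace ℝ (Fin d)) (ρ : Measure X) :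
    Matrix (Fin d) (Fin d) ℝ :=
  Matrix.of fun i j => ∫ x, φ x i * φ x j ∂ρ

variable {φ : X → EuclideanSpace ℝ (Fin d)}

theorem measurable_coord (hφ : Measurable φ) (i : Fin d) : Measurable fun x => φ x i := by
  fun_prop

theorem integrable_of_abs_le {ρ : Measure X} [IsFiniteMeasure ρ] {f : X → ℝ} (hf : Measurable f)
    (C : ℝ) (h : ∀ x, |f x| ≤ C) : Integrable f ρ :=
  Integrable.of_bound hf.aestronglyMeasurable C (ae_of_all _ h)

theorem integrable_coord_mul (hφ : Measurable φ) (h : ∀ x, ‖φ x‖ ≤ 1) (ρ : Measure X)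
    [IsFiniteMeasure ρ] (i j : Fin d) : Integrable (fun x => φ x i * φ x j) ρ := by
  refine integrable_of_abs_le ((measurable_coord hφ i).mul (measurable_coord hφ j)) 1 fun x => ?_
  rw [abs_mul]
  exact mul_le_one₀ (abs_coord_le_one h x i) (abs_nonneg _) (abs_coord_le_one h x j)

/-- With `A` an inverse covariance, this identifies the trace in the potential lemma with the mean
squared elliptic norm of the features. -/
theorem trace_mul_secondMoment (hφ : Measurable φ) (h : ∀ x, ‖φ x‖ ≤ 1) (ρ : Measure X)
    [IsFiniteMeasure ρ] (A : Matrix (Fin d) (Fin d) ℝ) :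
    (A * secondMoment φ ρ).trace = ∫ x, (φ x).ofLp ⬝ᵥ (A *ᵥ (φ x).ofLp) ∂ρ := by
  simp only [Matrix.trace, Matrix.diag, Matrix.mul_apply, secondMoment, Matrix.of_apply,
    dotProduct, Matrix.mulVec, Finset.mul_sum]
  have hint : ∀ i j, Integrable (fun x => φ x i * (A i j * φ x j)) ρ := fun i j => by
    convert (integrable_coord_mul hφ h ρ i j).const_mul (A i j) using 2; ring
  rw [integral_finsetSum _ fun i _ => integrable_finsetSum _ fun j _ => hint i j]
  refine Finset.sum_congr rfl fun i _ => ?_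
  rw [integral_finsetSum _ fun j _ => hint i j]
  refine Finset.sum_congr rfl fun j _ => ?_
  rw [← integral_const_mul]
  congr 1; ext x; ring

theorem quadForm_secondMoment (hφ : Measurable φ) (h : ∀ x, ‖φ x‖ ≤ 1) (ρ : Measure X)
    [IsFiniteMeasure ρ] (v : Fin d → ℝ) :
    v ⬝ᵥ (secondMoment φ ρ *ᵥ v) = ∫ x, ((φ x).ofLp ⬝ᵥ v) ^ 2 ∂ρ := by
  have h1 : v ⬝ᵥ (secondMoment φ ρ *ᵥ v) = (Matrix.vecMulVec v v * secondMoment φ ρ).trace := by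
    rw [Matrix.vecMulVec_mul, Matrix.trace_vecMulVec, dotProduct_comm v (v ᵥ* _),
      ← Matrix.dotProduct_mulVec]
  rw [h1, trace_mul_secondMoment hφ h]
  congr 1; ext x
  rw [Matrix.vecMulVec_mulVec]
  simp [dotProduct_comm v, sq]

theorem secondMoment_isHermitian (ρ : Measure X) : (secondMoment φ ρ).IsHermitian := by
  ext i j
  simp [secondMoment, mul_comm]

theorem secondMoment_posSemidef (hφ : Measurable φ) (h : ∀ x, ‖φ x‖ ≤ 1) (ρ : Measure X)
    [IsFiniteMeasure ρ] : (secondMoment φ ρ).PosSemidef := by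
  refine .of_dotProduct_mulVec_nonneg (secondMoment_isHermitian ρ) fun v => ?_
  rw [star_trivial, quadForm_secondMoment hφ h]
  exact integral_nonneg fun x => sq_nonneg _

theorem quadForm_secondMoment_le (hφ : Measurable φ) (h : ∀ x, ‖φ x‖ ≤ 1) (ρ : Measure X)
    [IsProbabilityMeasure ρ] (v : Fin d → ℝ) :
    v ⬝ᵥ (secondMoment φ ρ *ᵥ v) ≤ v ⬝ᵥ v := by
  rw [quadForm_secondMoment hφ h]
  calc _ ≤ ∫ x, (v ⬝ᵥ v) ∂ρ := by
        refine integral_mono_of_nonneg (ae_of_all _ fun x => sq_nonneg _) (integrable_const _)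
          (ae_of_all _ fun x => sq_dotProduct_le h x v)
    _ = _ := by simp

end SecondMoment

/-! ### A dimension-free Hoeffding inequality through `cosh ‖·‖`. -/

section HilbertHoeffding

variable {F : Type*} [NormedAddCommGroup F] [InnerProductSpace ℝ F]

/-- The base on the left is the convex combination of `(a + b)²` and `(a - b)²` with weights `(1 ±
y)/2`, and `u ↦ u ^ k` is convex on `[0, ∞)`. -/
theorem sq_add_le_chord {a b y : ℝ} (hy : |y| ≤ 1) (k : ℕ) :
    (a ^ 2 + b ^ 2 + 2 * a * b * y) ^ k ≤
      (1 + y) / 2 * (a + b) ^ (2 * k) + (1 - y) / 2 * (a - b) ^ (2 * k) := by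
  have hy' := abs_le.1 hy
  have h := (convexOn_pow (𝕜 := ℝ) k).2 (Set.mem_Ici.2 (sq_nonneg (a + b)))
    (Set.mem_Ici.2 (sq_nonneg (a - b))) (show 0 ≤ (1 + y) / 2 by linarith)
    (show 0 ≤ (1 - y) / 2 by linarith) (by ring)
  simp only [smul_eq_mul, ← pow_mul] at h
  rw [show a ^ 2 + b ^ 2 + 2 * a * b * y =
    (1 + y) / 2 * (a + b) ^ 2 + (1 - y) / 2 * (a - b) ^ 2 by ring]
  exact h

/-- `cosh ‖s + x‖ ≤ cosh ‖s‖ cosh b + κ ⟪s, x⟫` for `‖x‖ ≤ b`: the function `u ↦ cosh √u` is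
convex and hence below its chords. -/
theorem exists_cosh_norm_add_le (s : F) {b : ℝ} (hb : 0 < b) :
    ∃ κ : ℝ, ∀ x : F, ‖x‖ ≤ b →
      Real.cosh ‖s + x‖ ≤ Real.cosh ‖s‖ * Real.cosh b + κ * inner ℝ s x := by
  rcases (norm_nonneg s).eq_or_lt with h0 | ha
  · refine ⟨0, fun x hx => ?_⟩
    have hs : s = 0 := norm_eq_zero.1 h0.symm
    subst hs
    simp only [zero_add, norm_zero, Real.cosh_zero, one_mul, zero_mul, add_zero]
    rw [Real.cosh_le_cosh, abs_of_nonneg (norm_nonneg x), abs_of_pos hb]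
    exact hx
  · set a := ‖s‖ with hadef
    refine ⟨Real.sinh a * Real.sinh b / (a * b), fun x hx => ?_⟩
    set y := inner ℝ s x / (a * b) with hy
    have hab : 0 < a * b := mul_pos ha hb
    have hin : inner ℝ s x = a * b * y := by rw [hy]; field_simp
    have hy1 : |y| ≤ 1 := by
      rw [hy, abs_div, abs_of_pos hab, div_le_one hab]
      exact (abs_real_inner_le_norm s x).trans (mul_le_mul_of_nonneg_left hx ha.le)
    have hsq : ‖s + x‖ ^ 2 ≤ a ^ 2 + b ^ 2 + 2 * a * b * y := by
      rw [norm_add_sq_real, hin]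
      nlinarith [norm_nonneg x]
    -- The series of `cosh` has only even powers, so it is a series in the squared norm and the
    -- chord bound applies term by term.
    have hsum := ((Real.hasSum_cosh (a + b)).mul_left ((1 + y) / 2)).add
      ((Real.hasSum_cosh (a - b)).mul_left ((1 - y) / 2))
    have hle := hasSum_le (fun k => ?_) (Real.hasSum_cosh ‖s + x‖) hsum
    · rw [Real.cosh_add, Real.cosh_sub] at hle
      have : Real.sinh a * Real.sinh b / (a * b) * inner ℝ s x = y * (Real.sinh a * Real.sinh b) := by
        rw [hin]; field_simp
      rw [this]
      linarith
    · have h1 : ‖s + x‖ ^ (2 * k) ≤ (a ^ 2 + b ^ 2 + 2 * a * b * y) ^ k := by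
        rw [pow_mul]
        exact pow_le_pow_left₀ (sq_nonneg _) hsq k
      have h2 := h1.trans (sq_add_le_chord hy1 k)
      have hf : (0 : ℝ) < ((2 * k).factorial : ℝ) := by positivity
      calc _ ≤ ((1 + y) / 2 * (a + b) ^ (2 * k) + (1 - y) / 2 * (a - b) ^ (2 * k)) /
            ((2 * k).factorial : ℝ) := div_le_div_of_nonneg_right h2 hf.le
        _ = _ := by ring

theorem integrable_cosh_norm {F : Type*} [NormedAddCommGroup F] [MeasurableSpace F] [BorelSpace F]
    {Ω : Type*} [MeasurableSpace Ω] {ρ : Measure Ω} [IsFiniteMeasure ρ] {Y : Ω → F} (hY : Measurable Y)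
    {C : ℝ} (hC : ∀ ω, ‖Y ω‖ ≤ C) : Integrable (fun ω => Real.cosh ‖Y ω‖) ρ := by
  refine Integrable.of_bound (C := Real.cosh C)
    (Real.continuous_cosh.measurable.comp hY.norm).aestronglyMeasurable (ae_of_all _ fun ω => ?_)
  rw [Real.norm_eq_abs, abs_of_pos (Real.cosh_pos _), Real.cosh_le_cosh, abs_norm]
  exact (hC ω).trans (le_abs_self C)

variable [CompleteSpace F] [MeasurableSpace F] [BorelSpace F] [SecondCountableTopology F]
  {Ω : Type*} [MeasurableSpace Ω]

/-- The coefficient `κ` does not depend on the increment, so the linear term integrates to zero for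
a centred `Y`. -/
theorem integral_cosh_norm_add_le {ρ : Measure Ω} [IsProbabilityMeasure ρ] {Y : Ω → F}
    (hY : Measurable Y) {b : ℝ} (hb : 0 < b) (hYb : ∀ ω, ‖Y ω‖ ≤ b) (h0 : ∫ ω, Y ω ∂ρ = 0) (s : F) :
    ∫ ω, Real.cosh ‖s + Y ω‖ ∂ρ ≤ Real.cosh ‖s‖ * Real.cosh b := by
  obtain ⟨κ, hκ⟩ := exists_cosh_norm_add_le s hb
  have hint : Integrable Y ρ := Integrable.of_bound hY.aestronglyMeasurable b (ae_of_all _ hYb)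
  have hin : Integrable (fun ω => inner ℝ s (Y ω)) ρ := hint.const_inner s
  have h1 : ∫ ω, inner ℝ s (Y ω) ∂ρ = 0 := by
    rw [integral_inner hint, h0, inner_zero_right]
  calc ∫ ω, Real.cosh ‖s + Y ω‖ ∂ρ
      ≤ ∫ ω, (Real.cosh ‖s‖ * Real.cosh b + κ * inner ℝ s (Y ω)) ∂ρ := by
        refine integral_mono (integrable_cosh_norm (C := ‖s‖ + b) (hY.const_add s) fun ω => ?_)
          ((integrable_const _).add (hin.const_mul κ)) fun ω => hκ _ (hYb ω)
        exact (norm_add_le _ _).trans (by linarith [hYb ω])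
    _ = _ := by
        rw [integral_add (integrable_const _) (hin.const_mul κ), integral_const_mul κ, h1]
        simp

/-- Each independent summand costs one factor `cosh b`. The arbitrary offset `s` lets the induction
absorb the summand that is peeled off. -/
theorem integral_cosh_norm_add_sum_le {ρ : Measure Ω} [IsProbabilityMeasure ρ] {Y : Ω → F}
    (hY : Measurable Y) {b : ℝ} (hb : 0 < b) (hYb : ∀ ω, ‖Y ω‖ ≤ b) (h0 : ∫ ω, Y ω ∂ρ = 0)
    (K : ℕ) (s : F) :
    ∫ x : Fin K → Ω, Real.cosh ‖s + ∑ i, Y (x i)‖ ∂(Measure.pi fun _ => ρ) ≤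
      Real.cosh ‖s‖ * Real.cosh b ^ K := by
  induction K generalizing s with
  | zero => simp
  | succ K ih =>
    have hmp := (measurePreserving_piFinSuccAbove (fun _ : Fin (K + 1) => ρ) 0).symm
    have hmeas : Measurable fun q : Ω × (Fin K → Ω) => (s + Y q.1) + ∑ i, Y (q.2 i) := by
      refine ((hY.comp measurable_fst).const_add s).add (Finset.measurable_sum _ fun i _ => ?_)
      exact hY.comp ((measurable_pi_apply i).comp measurable_snd)
    have hbound : ∀ q : Ω × (Fin K → Ω), ‖(s + Y q.1) + ∑ i, Y (q.2 i)‖ ≤ ‖s‖ + b + K * b := by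
      intro q
      have h1 : ‖∑ i, Y (q.2 i)‖ ≤ K * b := by
        refine (norm_sum_le _ _).trans ((Finset.sum_le_sum fun i _ => hYb (q.2 i)).trans ?_)
        simp
      linarith [norm_add_le (s + Y q.1) (∑ i, Y (q.2 i)), norm_add_le s (Y q.1), hYb q.1]
    calc ∫ x : Fin (K + 1) → Ω, Real.cosh ‖s + ∑ i, Y (x i)‖ ∂(Measure.pi fun _ => ρ)
        = ∫ q : Ω × (Fin K → Ω), Real.cosh ‖(s + Y q.1) + ∑ i, Y (q.2 i)‖
            ∂(ρ.prod (Measure.pi fun _ => ρ)) := by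
          rw [← hmp.integral_comp']
          simp [MeasurableEquiv.piFinSuccAbove_symm_apply, Fin.insertNthEquiv,
            Fin.sum_univ_succ, add_assoc]
      _ = ∫ ω, ∫ x : Fin K → Ω, Real.cosh ‖(s + Y ω) + ∑ i, Y (x i)‖ ∂(Measure.pi fun _ => ρ) ∂ρ :=
          integral_prod _ (integrable_cosh_norm hmeas hbound)
      _ ≤ ∫ ω, Real.cosh ‖s + Y ω‖ * Real.cosh b ^ K ∂ρ := by
          refine integral_mono (integrable_cosh_norm hmeas hbound).integral_prod_left
            (Integrable.mul_const (integrable_cosh_norm (C := ‖s‖ + b) (hY.const_add s) fun ω => ?_) _)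
            fun ω => ih (s + Y ω)
          exact (norm_add_le _ _).trans (by linarith [hYb ω])
      _ = (∫ ω, Real.cosh ‖s + Y ω‖ ∂ρ) * Real.cosh b ^ K := integral_mul_const _ _
      _ ≤ (Real.cosh ‖s‖ * Real.cosh b) * Real.cosh b ^ K :=
          mul_le_mul_of_nonneg_right (integral_cosh_norm_add_le hY hb hYb h0 s)
            (pow_nonneg (Real.cosh_pos _).le _)
      _ = _ := by ring

/-- Dimension-free Hoeffding inequality for i.i.d. bounded centred vectors of a Hilbert space. -/
theorem measureReal_norm_sum_ge_le {ρ : Measure Ω} [IsProbabilityMeasure ρ] {Y : Ω → F}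
    (hY : Measurable Y) {b : ℝ} (hb : 0 < b) (hYb : ∀ ω, ‖Y ω‖ ≤ b) (h0 : ∫ ω, Y ω ∂ρ = 0)
    (K : ℕ) {t : ℝ} (ht : 0 < t) :
    (Measure.pi fun _ : Fin K => ρ).real {x | K * t ≤ ‖∑ i, Y (x i)‖} ≤
      2 * Real.exp (-(K * t ^ 2 / (2 * b ^ 2))) := by
  -- This scale minimizes the exponent `K (l b)² / 2 - l K t` of the Chernoff bound; the factor 2 of
  -- the conclusion comes from `cosh u ≥ exp u / 2`.
  set l : ℝ := t / b ^ 2 with hl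
  have hl0 : 0 < l := by positivity
  have h1 := integral_cosh_norm_add_sum_le (ρ := ρ) (Y := fun ω => l • Y ω) (hY.const_smul l)
    (b := l * b) (by positivity) (fun ω => by
      rw [norm_smul, Real.norm_eq_abs, abs_of_pos hl0]
      exact mul_le_mul_of_nonneg_left (hYb ω) hl0.le) (by rw [integral_smul, h0, smul_zero]) K 0
  have hmeas : Measurable fun x : Fin K → Ω => ∑ i, l • Y (x i) :=
    Finset.measurable_sum _ fun i _ => (hY.const_smul l).comp (measurable_pi_apply i)
  have hint : Integrable (fun x : Fin K → Ω => Real.cosh ‖∑ i, l • Y (x i)‖)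
      (Measure.pi fun _ => ρ) := by
    refine integrable_cosh_norm (C := K * (l * b)) hmeas fun x => ?_
    have h1 : ∀ i ∈ Finset.univ, ‖l • Y (x i)‖ ≤ l * b := fun i _ => by
      rw [norm_smul, Real.norm_eq_abs, abs_of_pos hl0]
      exact mul_le_mul_of_nonneg_left (hYb _) hl0.le
    refine (norm_sum_le _ _).trans ((Finset.sum_le_sum h1).trans_eq (by simp))
  simp only [zero_add, norm_zero, Real.cosh_zero, one_mul] at h1
  have h2 := mul_meas_ge_le_integral_of_nonneg (ae_of_all _ fun x => (Real.cosh_pos _).le) hint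
    (Real.cosh (l * (K * t)))
  have hsub : {x : Fin K → Ω | K * t ≤ ‖∑ i, Y (x i)‖} ⊆
      {x | Real.cosh (l * (K * t)) ≤ Real.cosh ‖∑ i, l • Y (x i)‖} := by
    intro x hx
    have hx' : (K : ℝ) * t ≤ ‖∑ i, Y (x i)‖ := hx
    change Real.cosh _ ≤ Real.cosh _
    rw [Real.cosh_le_cosh, ← Finset.smul_sum, norm_smul, Real.norm_eq_abs l,
      abs_of_pos hl0, abs_of_nonneg (by positivity), abs_of_nonneg (by positivity)]
    exact mul_le_mul_of_nonneg_left hx' hl0.le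
  have h3 : (Measure.pi fun _ : Fin K => ρ).real {x | K * t ≤ ‖∑ i, Y (x i)‖} ≤
      (Measure.pi fun _ : Fin K => ρ).real
        {x | Real.cosh (l * (K * t)) ≤ Real.cosh ‖∑ i, l • Y (x i)‖} :=
    measureReal_mono hsub
  set m := (Measure.pi fun _ : Fin K => ρ).real {x | K * t ≤ ‖∑ i, Y (x i)‖}
  have hm : 0 ≤ m := measureReal_nonneg
  have h4 : Real.cosh (l * b) ^ K ≤ Real.exp (K * ((l * b) ^ 2 / 2)) := by
    rw [Real.exp_nat_mul]
    exact pow_le_pow_left₀ (Real.cosh_pos _).le (Real.cosh_le_exp_half_sq _) K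
  have h5 : Real.exp (l * (K * t)) / 2 ≤ Real.cosh (l * (K * t)) := by
    rw [Real.cosh_eq]
    linarith [Real.exp_pos (-(l * (K * t)))]
  have h6 : Real.exp (l * (K * t)) / 2 * m ≤ Real.exp (K * ((l * b) ^ 2 / 2)) :=
    calc _ ≤ Real.cosh (l * (K * t)) * m := mul_le_mul_of_nonneg_right h5 hm
      _ ≤ _ := (mul_le_mul_of_nonneg_left h3 (Real.cosh_pos _).le).trans (h2.trans (h1.trans h4))
  have h7 : -(K * t ^ 2 / (2 * b ^ 2)) = K * ((l * b) ^ 2 / 2) - l * (K * t) := by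
    rw [hl]; field_simp; ring
  rw [h7, Real.exp_sub, mul_div_assoc', le_div_iff₀ (Real.exp_pos _)]
  linarith

end HilbertHoeffding

/-! ### Linear transition models, their one-step errors, and value functions. -/

section Models

variable {S A : Type*} [MeasurableSpace S] [MeasurableSpace A] {d : ℕ}

namespace LinearModel

variable {E : Env S A d} (P Q : LinearModel E)

/-- The transition density as a real function. -/
noncomputable def pdf (x : S × A) (s : S) : ℝ := inner ℝ (E.φ x) (P.μ s)

theorem measurable_pdf : Measurable (Function.uncurry P.pdf) :=
  (E.φ_measurable.comp measurable_fst).inner (P.μ_measurable.comp measurable_snd)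

theorem measurable_pdf_right (x : S × A) : Measurable (P.pdf x) :=
  P.measurable_pdf.comp measurable_prodMk_left

theorem integrable_pdf (x : S × A) : Integrable (P.pdf x) E.base :=
  P.μ_integrable.const_inner _

theorem pdf_nonneg (x : S × A) : ∀ᵐ s ∂E.base, 0 ≤ P.pdf x s := P.nonneg x

theorem integral_pdf (x : S × A) : ∫ s, P.pdf x s ∂E.base = 1 := by
  rw [integral_eq_lintegral_of_nonneg_ae (P.pdf_nonneg x)
    (P.measurable_pdf_right x).aestronglyMeasurable]
  have := P.lintegral_eq_one x
  unfold pdf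
  rw [this, ENNReal.toReal_one]

theorem kernel_apply (x : S × A) : P.kernel x = E.base.withDensity (P.density x) := by
  rw [LinearModel.kernel, Kernel.withDensity_apply _ P.measurable_density, Kernel.const_apply]

theorem measurable_density_right (x : S × A) : Measurable (P.density x) :=
  P.measurable_density.comp measurable_prodMk_left

theorem integral_kernel (x : S × A) (f : S → ℝ) :
    ∫ s, f s ∂P.kernel x = ∫ s, P.pdf x s * f s ∂E.base := by
  rw [kernel_apply, integral_withDensity_eq_integral_toReal_smul (P.measurable_density_right x)
    (ae_of_all _ fun s => ENNReal.ofReal_lt_top)]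
  refine integral_congr_ae ?_
  filter_upwards [P.pdf_nonneg x] with s hs
  change (ENNReal.ofReal (P.pdf x s)).toReal * f s = _
  rw [ENNReal.toReal_ofReal hs]

theorem integrable_smul_μ {f : S → ℝ} (hf : Measurable f) {C : ℝ} (hC : ∀ s, |f s| ≤ C) :
    Integrable (fun s => f s • P.μ s) E.base :=
  P.μ_integrable.bdd_smul C hf.aestronglyMeasurable (ae_of_all _ hC)

theorem integral_kernel_eq_inner {f : S → ℝ} (hf : Measurable f) {C : ℝ} (hC : ∀ s, |f s| ≤ C)
    (x : S × A) : ∫ s, f s ∂P.kernel x = inner ℝ (E.φ x) (∫ s, f s • P.μ s ∂E.base) := by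
  rw [integral_kernel, ← integral_inner (P.integrable_smul_μ hf hC)]
  refine integral_congr_ae (ae_of_all _ fun s => ?_)
  simp only [pdf, inner_smul_right]
  ring

theorem norm_integral_smul_le {f : S → ℝ} (hf : Measurable f) {C : ℝ} (hC0 : 0 ≤ C)
    (hC : ∀ s, |f s| ≤ C) : ‖∫ s, f s • P.μ s ∂E.base‖ ≤ C * √(d : ℝ) := by
  rcases hC0.eq_or_lt with h0 | h0
  · have : ∀ s, f s = 0 := fun s => by simpa [← h0] using hC s
    simp [this, ← h0]
  · have h1 := P.norm_le (fun s => C⁻¹ * f s) (hf.const_mul _) fun s => by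
      rw [abs_mul, abs_of_pos (inv_pos.2 h0), inv_mul_le_iff₀ h0, mul_one]
      exact hC s
    simp only [mul_smul, integral_smul] at h1
    rw [norm_smul, Real.norm_eq_abs, abs_of_pos (inv_pos.2 h0), inv_mul_le_iff₀ h0] at h1
    exact h1

/-- The Bhattacharyya affinity `∫ √(P(s' | x) Q(s' | x)) ds'`. -/
noncomputable def affinity (x : S × A) : ℝ := ∫ s, √(P.pdf x s * Q.pdf x s) ∂E.base

theorem sqrt_mul_le_half_add {a b : ℝ} (ha : 0 ≤ a) (hb : 0 ≤ b) : √(a * b) ≤ (a + b) / 2 := by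
  rw [Real.sqrt_mul ha]
  nlinarith [Real.sq_sqrt ha, Real.sq_sqrt hb, sq_nonneg (√a - √b)]

theorem integrable_sqrt_mul_pdf (x : S × A) :
    Integrable (fun s => √(P.pdf x s * Q.pdf x s)) E.base := by
  refine (((P.integrable_pdf x).add (Q.integrable_pdf x)).div_const 2).mono'
    ((P.measurable_pdf_right x).mul (Q.measurable_pdf_right x)).sqrt.aestronglyMeasurable ?_
  filter_upwards [P.pdf_nonneg x, Q.pdf_nonneg x] with s h1 h2
  rw [Real.norm_eq_abs, abs_of_nonneg (Real.sqrt_nonneg _)]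
  exact sqrt_mul_le_half_add h1 h2

theorem affinity_nonneg (x : S × A) : 0 ≤ P.affinity Q x :=
  integral_nonneg fun _ => Real.sqrt_nonneg _

theorem affinity_le_one (x : S × A) : P.affinity Q x ≤ 1 := by
  calc P.affinity Q x ≤ ∫ s, (P.pdf x s + Q.pdf x s) / 2 ∂E.base := by
        refine integral_mono_ae (integrable_sqrt_mul_pdf P Q x)
          (((P.integrable_pdf x).add (Q.integrable_pdf x)).div_const 2) ?_
        filter_upwards [P.pdf_nonneg x, Q.pdf_nonneg x] with s h1 h2
        exact sqrt_mul_le_half_add h1 h2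
    _ = 1 := by
        rw [integral_div, integral_add (P.integrable_pdf x) (Q.integrable_pdf x), P.integral_pdf,
          Q.integral_pdf]
        norm_num

theorem measurable_affinity : Measurable (P.affinity Q) := by
  have h : Measurable fun q : (S × A) × S => √(P.pdf q.1 q.2 * Q.pdf q.1 q.2) :=
    (P.measurable_pdf.mul Q.measurable_pdf).sqrt
  exact h.stronglyMeasurable.integral_prod_right'.measurable

/-- With `u = √a` and `v = √b`, this is the weighted arithmetic–geometric inequality for `|v - u| ·
(v + u)`. It is affine in `a`, `b` and `√(a b)`, so it can be integrated directly, and `t` is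
optimized afterwards; this replaces Cauchy–Schwarz for integrals. -/
theorem abs_sub_le_add_mul {a b t : ℝ} (ha : 0 ≤ a) (hb : 0 ≤ b) (ht : 0 < t) :
    |b - a| ≤ t * ((a + b) / 2 - √(a * b)) + ((a + b) / 2 + √(a * b)) / t := by
  rw [Real.sqrt_mul ha]
  set u := √a
  set v := √b
  have hu : u ^ 2 = a := Real.sq_sqrt ha
  have hv : v ^ 2 = b := Real.sq_sqrt hb
  have h1 : t * ((a + b) / 2 - u * v) + ((a + b) / 2 + u * v) / t =
      (t * (v - u) ^ 2 + (v + u) ^ 2 / t) / 2 := by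
    rw [← hu, ← hv]; field_simp; ring
  have h2 : t * (v - u) ^ 2 + (v + u) ^ 2 / t = (t * (v - u) - (v + u)) ^ 2 / t + 2 * (b - a) := by
    rw [← hu, ← hv]; field_simp; ring
  have h3 : t * (v - u) ^ 2 + (v + u) ^ 2 / t = (t * (v - u) + (v + u)) ^ 2 / t - 2 * (b - a) := by
    rw [← hu, ← hv]; field_simp; ring
  have h4 : 0 ≤ (t * (v - u) - (v + u)) ^ 2 / t := by positivity
  have h5 : 0 ≤ (t * (v - u) + (v + u)) ^ 2 / t := by positivity
  rw [h1, abs_le]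
  constructor <;> linarith

/-- The Hellinger bound on the `L¹` distance between densities. -/
theorem sq_integral_abs_sub_le (x : S × A) :
    (∫ s, |Q.pdf x s - P.pdf x s| ∂E.base) ^ 2 ≤ 8 * (1 - P.affinity Q x) := by
  set u := ∫ s, |Q.pdf x s - P.pdf x s| ∂E.base with hu
  set a := P.affinity Q x with ha
  have ha1 := P.affinity_le_one Q x
  have hu0 : 0 ≤ u := integral_nonneg fun _ => abs_nonneg _
  have key : ∀ t : ℝ, 0 < t → u ≤ t * (1 - a) + 2 / t := by
    intro t ht
    have hi1 : Integrable (fun s => (P.pdf x s + Q.pdf x s) / 2) E.base :=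
      ((P.integrable_pdf x).add (Q.integrable_pdf x)).div_const 2
    have hi2 := integrable_sqrt_mul_pdf P Q x
    have e1 : ∫ s, (P.pdf x s + Q.pdf x s) / 2 ∂E.base = 1 := by
      rw [integral_div, integral_add (P.integrable_pdf x) (Q.integrable_pdf x), P.integral_pdf,
        Q.integral_pdf]
      norm_num
    calc u ≤ ∫ s, (t * ((P.pdf x s + Q.pdf x s) / 2 - √(P.pdf x s * Q.pdf x s)) +
          ((P.pdf x s + Q.pdf x s) / 2 + √(P.pdf x s * Q.pdf x s)) / t) ∂E.base := by
          refine integral_mono_ae ((Q.integrable_pdf x).sub (P.integrable_pdf x)).abs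
            (((hi1.sub hi2).const_mul t).add ((hi1.add hi2).div_const t)) ?_
          filter_upwards [P.pdf_nonneg x, Q.pdf_nonneg x] with s h1 h2
          exact abs_sub_le_add_mul h1 h2 ht
      _ = t * (1 - a) + (1 + a) / t := by
          have hs : Integrable (fun s => (P.pdf x s + Q.pdf x s) / 2 - √(P.pdf x s * Q.pdf x s))
            E.base := hi1.sub hi2
          have ha : Integrable (fun s => (P.pdf x s + Q.pdf x s) / 2 + √(P.pdf x s * Q.pdf x s))
            E.base := hi1.add hi2
          rw [integral_add (hs.const_mul t) (ha.div_const t),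
            integral_const_mul, integral_div, integral_sub hi1 hi2, integral_add hi1 hi2, e1]
          rfl
      _ ≤ _ := by
          have : (1 + a) / t ≤ 2 / t := div_le_div_of_nonneg_right (by linarith) ht.le
          linarith
  rcases hu0.eq_or_lt with h0 | h0
  · rw [← h0]; nlinarith
  · have h1 := key (4 / u) (by positivity)
    have h2 : 4 / u * (1 - a) + 2 / (4 / u) = (4 * (1 - a)) / u + u / 2 := by
      field_simp; ring
    rw [h2] at h1
    have h3 : u / 2 ≤ 4 * (1 - a) / u := by linarith
    rw [le_div_iff₀ h0] at h3
    linarith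

/-- The one-step model error for a function with values in `[0, B]` is linear in the features. -/
theorem exists_modelError {V : S → ℝ} (hV : Measurable V) {B : ℝ} (hV0 : ∀ s, 0 ≤ V s)
    (hVB : ∀ s, V s ≤ B) (hB : 0 ≤ B) :
    ∃ θ : EuclideanSpace ℝ (Fin d), ‖θ‖ ≤ B * √(d : ℝ) ∧ ∀ x,
      (∫ s, V s ∂Q.kernel x) - ∫ s, V s ∂P.kernel x = inner ℝ (E.φ x) θ ∧
      (inner ℝ (E.φ x) θ) ^ 2 ≤ 2 * B ^ 2 * (1 - P.affinity Q x) := by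
  -- Both kernels have mass one, so centring leaves the error unchanged while halving the sup norm:
  -- the two integrals against `μ` contribute `B/2 · √d` each, and the squared error gets `(B/2)² ·
  -- 8 = 2 B²`.
  set W : S → ℝ := fun s => V s - B / 2 with hW
  have hWm : Measurable W := hV.sub_const _
  have hWB : ∀ s, |W s| ≤ B / 2 := fun s => by
    rw [abs_le]; constructor <;> simp only [hW] <;> linarith [hV0 s, hVB s]
  have hVi : ∀ (U : LinearModel E) x, Integrable V (U.kernel x) := fun U x =>
    integrable_of_abs_le hV B fun s => by rw [abs_of_nonneg (hV0 s)]; exact hVB s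
  have hVW : ∀ (U : LinearModel E) x, ∫ s, W s ∂U.kernel x = (∫ s, V s ∂U.kernel x) - B / 2 := by
    intro U x
    simp only [hW]
    rw [integral_sub (hVi U x) (integrable_const _)]
    simp
  refine ⟨∫ s, W s • Q.μ s ∂E.base - ∫ s, W s • P.μ s ∂E.base, ?_, fun x => ?_⟩
  · refine (norm_sub_le _ _).trans ?_
    linarith [Q.norm_integral_smul_le hWm (by linarith) hWB,
      P.norm_integral_smul_le hWm (by linarith) hWB]
  · have h1 : (∫ s, V s ∂Q.kernel x) - ∫ s, V s ∂P.kernel x =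
        (∫ s, W s ∂Q.kernel x) - ∫ s, W s ∂P.kernel x := by rw [hVW, hVW]; ring
    have h2 : (∫ s, W s ∂Q.kernel x) - ∫ s, W s ∂P.kernel x = inner ℝ (E.φ x)
        (∫ s, W s • Q.μ s ∂E.base - ∫ s, W s • P.μ s ∂E.base) := by
      rw [inner_sub_right, Q.integral_kernel_eq_inner hWm hWB, P.integral_kernel_eq_inner hWm hWB]
    refine ⟨h1.trans h2, ?_⟩
    have hi : ∀ U : LinearModel E, Integrable (fun s => U.pdf x s * W s) E.base := fun U =>
      (U.integrable_pdf x).mul_bdd (c := B / 2) hWm.aestronglyMeasurable (ae_of_all _ hWB)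
    have h3 : |(∫ s, W s ∂Q.kernel x) - ∫ s, W s ∂P.kernel x| ≤
        B / 2 * ∫ s, |Q.pdf x s - P.pdf x s| ∂E.base := by
      rw [integral_kernel, integral_kernel, ← integral_sub (hi Q) (hi P), ← integral_const_mul]
      refine abs_integral_le_integral_abs.trans (integral_mono ((hi Q).sub (hi P)).abs
        (((Q.integrable_pdf x).sub (P.integrable_pdf x)).abs.const_mul _) fun s => ?_)
      change |Q.pdf x s * W s - P.pdf x s * W s| ≤ B / 2 * |Q.pdf x s - P.pdf x s|
      rw [← sub_mul, abs_mul, mul_comm]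
      exact mul_le_mul_of_nonneg_right (hWB s) (abs_nonneg _)
    rw [← h2, ← sq_abs]
    calc _ ≤ (B / 2 * ∫ s, |Q.pdf x s - P.pdf x s| ∂E.base) ^ 2 :=
          pow_le_pow_left₀ (abs_nonneg _) h3 2
      _ = (B / 2) ^ 2 * (∫ s, |Q.pdf x s - P.pdf x s| ∂E.base) ^ 2 := by ring
      _ ≤ (B / 2) ^ 2 * (8 * (1 - P.affinity Q x)) :=
          mul_le_mul_of_nonneg_left (P.sq_integral_abs_sub_le Q x) (sq_nonneg _)
      _ = _ := by ring

end LinearModel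

/-! ### Value functions and the simulation lemma -/

/-- Expected reward of `pol` over the `k` steps starting at time `h`, as a function of the state at
time `h`. -/
noncomputable def value (P : Kernel (S × A) S) (pol : Policy S A) (f : S × A → ℝ) :
    ℕ → ℕ → S → ℝ
  | 0, _, _ => 0
  | k + 1, h, s => ∫ a, (f (s, a) + ∫ s', value P pol f k (h + 1) s' ∂P (s, a)) ∂pol.step h s

variable (P : Kernel (S × A) S) (pol : Policy S A) {f : S × A → ℝ}

theorem measurable_integral_kernel {X Y : Type*} [MeasurableSpace X] [MeasurableSpace Y]
    (κ : Kernel X Y) {V : Y → ℝ} (hV : Measurable V) : Measurable fun x => ∫ y, V y ∂κ x :=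
  hV.stronglyMeasurable.integral_kernel.measurable

theorem measurable_value (hf : Measurable f) (k h : ℕ) : Measurable (value P pol f k h) := by
  induction k generalizing h with
  | zero => exact measurable_const
  | succ k ih =>
    have h1 : Measurable fun x : S × A => f x + ∫ s', value P pol f k (h + 1) s' ∂P x :=
      hf.add (measurable_integral_kernel P (ih (h + 1)))
    exact (h1.stronglyMeasurable.integral_kernel_prod_right' (κ := pol.step h)).measurable

variable [IsMarkovKernel P]

theorem integral_mem_Icc {X : Type*} [MeasurableSpace X] (ρ : Measure X) [IsProbabilityMeasure ρ]
    {V : X → ℝ} (hV : Measurable V) {B : ℝ} (h0 : ∀ x, 0 ≤ V x) (hB : ∀ x, V x ≤ B) :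
    0 ≤ ∫ x, V x ∂ρ ∧ ∫ x, V x ∂ρ ≤ B := by
  refine ⟨integral_nonneg h0, ?_⟩
  calc ∫ x, V x ∂ρ ≤ ∫ _, B ∂ρ := integral_mono
        (integrable_of_abs_le hV B fun s => by rw [abs_of_nonneg (h0 s)]; exact hB s)
        (integrable_const _) hB
    _ = B := by simp

theorem value_mem_Icc (hf : Measurable f) {c : ℝ} (h0 : ∀ x, 0 ≤ f x) (hc : ∀ x, f x ≤ c)
    (k h : ℕ) (s : S) : 0 ≤ value P pol f k h s ∧ value P pol f k h s ≤ k * c := by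
  induction k generalizing h s with
  | zero => simp [value]
  | succ k ih =>
    have h1 : Measurable fun x : S × A => f x + ∫ s', value P pol f k (h + 1) s' ∂P x :=
      hf.add (measurable_integral_kernel P (measurable_value P pol hf k (h + 1)))
    have h2 := fun x => integral_mem_Icc (P x) (measurable_value P pol hf k (h + 1))
      (fun s => (ih (h + 1) s).1) (fun s => (ih (h + 1) s).2)
    have h3 := integral_mem_Icc (pol.step h s) (h1.comp measurable_prodMk_left) (B := c + k * c)
      (fun a => add_nonneg (h0 (s, a)) (h2 (s, a)).1) (fun a => add_le_add (hc (s, a)) (h2 (s, a)).2)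
    refine ⟨h3.1, h3.2.trans_eq ?_⟩
    push_cast; ring

theorem integral_stateLaw_succ (s₀ : S) (h : ℕ) {V : S → ℝ} (hV : Measurable V) {B : ℝ}
    (hB : ∀ s, |V s| ≤ B) : ∫ s, V s ∂stateLaw P s₀ pol (h + 1) =
      ∫ x, ∫ s, V s ∂P x ∂stepLaw P s₀ pol h := by
  have h1 : Integrable V (stateLaw P s₀ pol (h + 1)) := integrable_of_abs_le hV B hB
  change Integrable V (P ∘ₘ stepLaw P s₀ pol h) at h1
  change ∫ s, V s ∂(P ∘ₘ stepLaw P s₀ pol h) = _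
  rw [Measure.comp_eq_comp_const_apply] at h1 ⊢
  rw [Kernel.integral_comp h1, Kernel.const_apply]

theorem integral_stepLaw (s₀ : S) (h : ℕ) {F : S × A → ℝ} (hF : Measurable F) {B : ℝ}
    (hB : ∀ x, |F x| ≤ B) : ∫ x, F x ∂stepLaw P s₀ pol h =
      ∫ s, ∫ a, F (s, a) ∂pol.step h s ∂stateLaw P s₀ pol h :=
  Measure.integral_compProd (integrable_of_abs_le hF B hB)

/-- The simulation lemma: the value of `pol` under `P`, averaged over the state law under `U`. -/
theorem integral_value_stateLaw (U : Kernel (S × A) S) [IsMarkovKernel U] (hf : Measurable f)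
    {c : ℝ} (h0 : ∀ x, 0 ≤ f x) (hc : ∀ x, f x ≤ c) (s₀ : S) (k h : ℕ) :
    ∫ s, value P pol f k h s ∂stateLaw U s₀ pol h = ∑ j ∈ Finset.range k,
      ((∫ x, f x ∂stepLaw U s₀ pol (h + j)) +
        ∫ x, ((∫ s, value P pol f (k - 1 - j) (h + j + 1) s ∂P x) -
          ∫ s, value P pol f (k - 1 - j) (h + j + 1) s ∂U x) ∂stepLaw U s₀ pol (h + j)) := by
  induction k generalizing h with
  | zero => simp [value]
  | succ k ih =>
    set V := value P pol f k (h + 1) with hV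
    have hVm : Measurable V := measurable_value P pol hf k (h + 1)
    have hVI := value_mem_Icc P pol hf h0 hc k (h + 1)
    have hVB : ∀ s, |V s| ≤ k * c := fun s => by
      rw [abs_of_nonneg (hVI s).1]; exact (hVI s).2
    have hm : ∀ (κ : Kernel (S × A) S), Measurable fun x => ∫ s, V s ∂κ x :=
      fun κ => measurable_integral_kernel κ hVm
    have hb : ∀ (κ : Kernel (S × A) S) [IsMarkovKernel κ] x, |∫ s, V s ∂κ x| ≤ k * c := by
      intro κ _ x
      have := integral_mem_Icc (κ x) hVm (fun s => (hVI s).1) (fun s => (hVI s).2)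
      rw [abs_of_nonneg this.1]; exact this.2
    have hfb : ∀ x, |f x| ≤ c := fun x => by rw [abs_of_nonneg (h0 x)]; exact hc x
    have hif : Integrable f (stepLaw U s₀ pol h) := integrable_of_abs_le hf c hfb
    have hiP : Integrable (fun x => ∫ s, V s ∂P x) (stepLaw U s₀ pol h) :=
      integrable_of_abs_le (hm P) _ (hb P)
    have hiR : Integrable (fun x => ∫ s, V s ∂U x) (stepLaw U s₀ pol h) :=
      integrable_of_abs_le (hm U) _ (hb U)
    have e1 : ∫ s, value P pol f (k + 1) h s ∂stateLaw U s₀ pol h =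
        ∫ x, (f x + (∫ s, V s ∂P x)) ∂stepLaw U s₀ pol h :=
      (integral_stepLaw U pol s₀ h (F := fun x => f x + ∫ s, V s ∂P x) (hf.add (hm P)) (B := c + k * c)
        fun x => (abs_add_le _ _).trans (add_le_add (hfb x) (hb P x))).symm
    -- After one unrolled step the continuation value is integrated against `P`. Replacing `P` by
    -- `U` costs the error term of time `h` and leaves the same statement at time `h + 1`.
    have e2 := ih (h + 1)
    rw [integral_stateLaw_succ U pol s₀ h hVm hVB] at e2
    rw [e1, integral_add hif hiP, Finset.sum_range_succ']
    have e3 : ∀ j, (k + 1 - 1 - (j + 1)) = k - 1 - j := fun j => by omega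
    have e4 : ∀ j, h + (j + 1) = h + 1 + j := fun j => by omega
    rw [Finset.sum_congr rfl fun j _ => by rw [e3 j, e4 j], ← e2]
    simp only [Nat.add_sub_cancel, Nat.sub_zero, Nat.add_zero]
    rw [integral_sub hiP hiR]
    ring

variable {E : Env S A d}

/-- The simulation lemma with both kernels equal, where every error term vanishes. -/
theorem value_initial_eq_J (hf : Measurable f) {c : ℝ} (h0 : ∀ x, 0 ≤ f x) (hc : ∀ x, f x ≤ c) :
    value P pol f E.H 0 E.s₀ = J E pol f P := by
  have h1 := integral_value_stateLaw P pol P hf h0 hc E.s₀ E.H 0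
  simp only [sub_self, integral_zero, add_zero, zero_add] at h1
  rw [show stateLaw P E.s₀ pol 0 = Measure.dirac E.s₀ from rfl, integral_dirac' _ _
    (measurable_value P pol hf _ _).stronglyMeasurable] at h1
  exact h1

/-- The value functions belong to `P` and the visited states to `U`. Optimism uses this with the
fitted model as `U`, the regret bound with the true one. -/
theorem J_eq_J_add_sum (U : Kernel (S × A) S) [IsMarkovKernel U] (hf : Measurable f)
    {c : ℝ} (h0 : ∀ x, 0 ≤ f x) (hc : ∀ x, f x ≤ c) :
    J E pol f P = J E pol f U + ∑ h ∈ Finset.range E.H,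
      ∫ x, ((∫ s, value P pol f (E.H - 1 - h) (h + 1) s ∂P x) -
          ∫ s, value P pol f (E.H - 1 - h) (h + 1) s ∂U x) ∂stepLaw U E.s₀ pol h := by
  have h1 := integral_value_stateLaw P pol U hf h0 hc E.s₀ E.H 0
  rw [show stateLaw U E.s₀ pol 0 = Measure.dirac E.s₀ from rfl, integral_dirac' _ _
    (measurable_value P pol hf _ _).stronglyMeasurable, value_initial_eq_J P pol hf h0 hc,
    Finset.sum_add_distrib] at h1
  simpa [J] using h1

end Models

/-! ### Maximum likelihood: a Chernoff bound by square roots of likelihood ratios. -/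

section Likelihood

variable {S A : Type*} [MeasurableSpace S] [MeasurableSpace A] {d : ℕ} {E : Env S A d}

namespace LinearModel

variable (P Q : LinearModel E)

/-- The square root of the likelihood ratio `Q / P`. -/
noncomputable def sqrtRatio (y : (S × A) × S) : ℝ := √(Q.pdf y.1 y.2 / P.pdf y.1 y.2)

theorem sqrtRatio_nonneg (y : (S × A) × S) : 0 ≤ P.sqrtRatio Q y := Real.sqrt_nonneg _

theorem measurable_sqrtRatio : Measurable (P.sqrtRatio Q) :=
  (Q.measurable_pdf.div P.measurable_pdf).sqrt

/-- Pointwise `P √(Q / P) = √(P Q)`, also where `P` vanishes, since division by zero yields zero.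
Stating it for `∫⁻` lets integrability follow from the finiteness of the value. -/
theorem lintegral_sqrtRatio (ρ : Measure (S × A)) [IsProbabilityMeasure ρ] :
    ∫⁻ y, ENNReal.ofReal (P.sqrtRatio Q y) ∂(ρ ⊗ₘ P.kernel) =
      ENNReal.ofReal (∫ x, P.affinity Q x ∂ρ) := by
  rw [Measure.lintegral_compProd (P.measurable_sqrtRatio Q).ennreal_ofReal,
    ofReal_integral_eq_lintegral_ofReal (integrable_of_abs_le (P.measurable_affinity Q) 1
      fun x => by rw [abs_of_nonneg (P.affinity_nonneg Q x)]; exact P.affinity_le_one Q x)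
      (ae_of_all _ (P.affinity_nonneg Q))]
  refine lintegral_congr fun x => ?_
  have hm : Measurable fun s => ENNReal.ofReal (P.sqrtRatio Q (x, s)) :=
    ((P.measurable_sqrtRatio Q).comp measurable_prodMk_left).ennreal_ofReal
  rw [kernel_apply, lintegral_withDensity_eq_lintegral_mul _ (P.measurable_density_right x) hm,
    affinity,
    ofReal_integral_eq_lintegral_ofReal (integrable_sqrt_mul_pdf P Q x)
      (ae_of_all _ fun s => Real.sqrt_nonneg _)]
  refine lintegral_congr_ae ?_
  filter_upwards [P.pdf_nonneg x, Q.pdf_nonneg x] with s h1 h2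
  change ENNReal.ofReal (P.pdf x s) * ENNReal.ofReal (√(Q.pdf x s / P.pdf x s)) = _
  rw [← ENNReal.ofReal_mul h1]
  congr 1
  rcases h1.eq_or_lt with h0 | h0
  · simp [← h0]
  · conv_lhs => rw [← Real.sqrt_sq h1]
    rw [← Real.sqrt_mul (sq_nonneg _), Real.sqrt_sq h1]
    congr 1
    field_simp

theorem integrable_sqrtRatio (ρ : Measure (S × A)) [IsProbabilityMeasure ρ] :
    Integrable (P.sqrtRatio Q) (ρ ⊗ₘ P.kernel) := by
  rw [← lintegral_ofReal_ne_top_iff_integrable (P.measurable_sqrtRatio Q).aestronglyMeasurable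
    (ae_of_all _ (P.sqrtRatio_nonneg Q)), lintegral_sqrtRatio]
  exact ENNReal.ofReal_ne_top

theorem integral_sqrtRatio (ρ : Measure (S × A)) [IsProbabilityMeasure ρ] :
    ∫ y, P.sqrtRatio Q y ∂(ρ ⊗ₘ P.kernel) = ∫ x, P.affinity Q x ∂ρ := by
  rw [integral_eq_lintegral_of_nonneg_ae (ae_of_all _ (P.sqrtRatio_nonneg Q))
    (P.measurable_sqrtRatio Q).aestronglyMeasurable, lintegral_sqrtRatio,
    ENNReal.toReal_ofReal (integral_nonneg fun x => P.affinity_nonneg Q x)]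

theorem ae_pdf_pos (ρ : Measure (S × A)) [IsProbabilityMeasure ρ] :
    ∀ᵐ y ∂(ρ ⊗ₘ P.kernel), 0 < P.pdf y.1 y.2 := by
  refine (Measure.ae_compProd_iff (measurableSet_lt measurable_const P.measurable_pdf)).2
    (ae_of_all _ fun x => ?_)
  rw [kernel_apply, ae_withDensity_iff (P.measurable_density_right x)]
  refine ae_of_all _ fun s hs => ?_
  by_contra h
  exact hs (ENNReal.ofReal_eq_zero.2 (not_lt.1 h))

theorem one_le_prod_sqrtRatio {M : ℕ} {y : Fin M → (S × A) × S}
    (hP : ∀ i, 0 < P.pdf (y i).1 (y i).2)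
    (h : ∏ i, P.density (y i).1 (y i).2 ≤ ∏ i, Q.density (y i).1 (y i).2) :
    1 ≤ ∏ i, P.sqrtRatio Q (y i) := by
  have hPp : 0 < ∏ i, P.pdf (y i).1 (y i).2 := Finset.prod_pos fun i _ => hP i
  change ∏ i, ENNReal.ofReal (P.pdf (y i).1 (y i).2) ≤
    ∏ i, ENNReal.ofReal (Q.pdf (y i).1 (y i).2) at h
  -- A single nonpositive factor would make the likelihood of `Q` zero, below the positive
  -- likelihood of `P`.
  have hQ : ∀ i, 0 < Q.pdf (y i).1 (y i).2 := by
    intro i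
    by_contra hi
    have h0 : ∏ i, ENNReal.ofReal (Q.pdf (y i).1 (y i).2) = 0 :=
      Finset.prod_eq_zero (Finset.mem_univ i) (ENNReal.ofReal_eq_zero.2 (not_lt.1 hi))
    rw [h0, ← ENNReal.ofReal_prod_of_nonneg fun i _ => (hP i).le] at h
    exact absurd (ENNReal.ofReal_eq_zero.1 (le_antisymm h (zero_le))) (not_le.2 hPp)
  rw [← ENNReal.ofReal_prod_of_nonneg fun i _ => (hP i).le,
    ← ENNReal.ofReal_prod_of_nonneg fun i _ => (hQ i).le,
    ENNReal.ofReal_le_ofReal_iff (Finset.prod_nonneg fun i _ => (hQ i).le)] at h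
  have h1 : ∏ i, P.sqrtRatio Q (y i) =
      √((∏ i, Q.pdf (y i).1 (y i).2) / ∏ i, P.pdf (y i).1 (y i).2) := by
    rw [← Finset.prod_div_distrib, Real.sqrt_prod]
    · rfl
    · exact fun i _ => div_nonneg (hQ i).le (hP i).le
  rw [h1, Real.one_le_sqrt, le_div_iff₀ hPp, one_mul]
  exact h

/-- Chernoff bound: a model is at least as likely as the true one with small probability. -/
theorem measure_prod_density_le (ρ : Measure (S × A)) [IsProbabilityMeasure ρ] (M : ℕ) :
    (Measure.pi fun _ : Fin M => ρ ⊗ₘ P.kernel)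
      {y | ∏ i, P.density (y i).1 (y i).2 ≤ ∏ i, Q.density (y i).1 (y i).2} ≤
      ENNReal.ofReal ((∫ x, P.affinity Q x ∂ρ) ^ M) := by
  set m := Measure.pi fun _ : Fin M => ρ ⊗ₘ P.kernel
  have h1 : ∀ᵐ y ∂m, ∀ i, 0 < P.pdf (y i).1 (y i).2 := by
    rw [ae_all_iff]
    intro i
    exact (Measure.tendsto_eval_ae_ae (μ := fun _ : Fin M => ρ ⊗ₘ P.kernel) (i := i)).eventually
      (P.ae_pdf_pos ρ)
  have hint : Integrable (fun y : Fin M → (S × A) × S => ∏ i, P.sqrtRatio Q (y i)) m :=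
    Integrable.fintype_prod fun _ => P.integrable_sqrtRatio Q ρ
  have h2 : m.real {y | 1 ≤ ∏ i, P.sqrtRatio Q (y i)} ≤ (∫ x, P.affinity Q x ∂ρ) ^ M := by
    -- Markov's inequality at level 1; by independence the mean of the product is the `M`-th power
    -- of the mean affinity.
    have h3 := mul_meas_ge_le_integral_of_nonneg
      (ae_of_all _ fun y => Finset.prod_nonneg fun i _ => P.sqrtRatio_nonneg Q (y i)) hint 1
    rw [one_mul] at h3
    refine h3.trans_eq ?_
    rw [integral_fintype_prod_eq_prod (fun _ => P.sqrtRatio Q)]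
    simp [integral_sqrtRatio]
  calc m {y | ∏ i, P.density (y i).1 (y i).2 ≤ ∏ i, Q.density (y i).1 (y i).2}
      ≤ m {y | 1 ≤ ∏ i, P.sqrtRatio Q (y i)} := by
        refine measure_mono_ae ?_
        filter_upwards [h1] with y hy hle using P.one_le_prod_sqrtRatio Q hy hle
    _ = ENNReal.ofReal (m.real {y | 1 ≤ ∏ i, P.sqrtRatio Q (y i)}) := by
        rw [ofReal_measureReal]
    _ ≤ _ := ENNReal.ofReal_le_ofReal h2

end LinearModel

/-- Comparisons of log-likelihoods become comparisons of products in `[0, ∞]`, where vanishing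
densities need no separate treatment. -/
theorem logLik_eq_log_prod {p : HyperParams} (P : LinearModel E) (b : Batch S A p) :
    logLik P b = ENNReal.log (∏ i, P.density (b.2 i).1 (b.2 i).2) := by
  unfold logLik
  induction (Finset.univ : Finset (Fin p.M)) using Finset.induction_on with
  | empty => simp
  | insert i s hi ih => rw [Finset.sum_insert hi, Finset.prod_insert hi, ENNReal.log_mul_add, ih]

theorem logLik_le_logLik_iff {p : HyperParams} (P Q : LinearModel E) (b : Batch S A p) :
    logLik P b ≤ logLik Q b ↔
      ∏ i, P.density (b.2 i).1 (b.2 i).2 ≤ ∏ i, Q.density (b.2 i).1 (b.2 i).2 := by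
  rw [logLik_eq_log_prod, logLik_eq_log_prod, ENNReal.log_le_log_iff]

theorem measurableSet_logLik_le {p : HyperParams} (P Q : LinearModel E) :
    MeasurableSet {b : Batch S A p | logLik P b ≤ logLik Q b} := by
  simp_rw [logLik_le_logLik_iff]
  have h : ∀ U : LinearModel E, Measurable fun b : Batch S A p =>
      ∏ i, U.density (b.2 i).1 (b.2 i).2 := fun U =>
    Finset.measurable_prod _ fun i _ =>
      U.measurable_density.comp ((measurable_pi_apply i).comp measurable_snd)
  exact measurableSet_le (h P) (h Q)

theorem measure_prod_density_le_exp (P Q : LinearModel E) (ρ : Measure (S × A))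
    [IsProbabilityMeasure ρ] (M : ℕ) {τ : ℝ} (hτ : τ ≤ 1 - ∫ x, P.affinity Q x ∂ρ) :
    (Measure.pi fun _ : Fin M => ρ ⊗ₘ P.kernel)
      {y | ∏ i, P.density (y i).1 (y i).2 ≤ ∏ i, Q.density (y i).1 (y i).2} ≤
      ENNReal.ofReal (Real.exp (-(M * τ))) := by
  refine (P.measure_prod_density_le Q ρ M).trans (ENNReal.ofReal_le_ofReal ?_)
  have h0 : 0 ≤ ∫ x, P.affinity Q x ∂ρ := integral_nonneg fun x => P.affinity_nonneg Q x
  rw [show -(M * τ) = M * (-τ) by ring, Real.exp_nat_mul]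
  refine pow_le_pow_left₀ h0 ?_ M
  linarith [Real.add_one_le_exp (-τ)]

end Likelihood

/-! ### Elliptic widths, optimism and the per-episode regret. -/

section Regret

variable {S A : Type*} [MeasurableSpace S] [MeasurableSpace A] {d : ℕ} {E : Env S A d}

/-- The population covariance `I + ∑_{i ≤ n} ∫ φ φᵀ dρ_i`. -/
noncomputable def popCov (E : Env S A d) (ρ : ℕ → Measure (S × A)) (n : ℕ) :
    Matrix (Fin d) (Fin d) ℝ :=
  1 + ∑ i ∈ Finset.range (n + 1), secondMoment E.φ (ρ i)

/-- The truncated elliptic width `min {√(d + 1) ‖φ(x)‖_{T⁻¹}, 1}`. -/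
noncomputable def width (E : Env S A d) (T : Matrix (Fin d) (Fin d) ℝ) (x : S × A) : ℝ :=
  min (√(((d : ℝ) + 1) * ((E.φ x).ofLp ⬝ᵥ (T⁻¹ *ᵥ (E.φ x).ofLp)))) 1

theorem measurable_quadForm (E : Env S A d) (T : Matrix (Fin d) (Fin d) ℝ) :
    Measurable fun x => (E.φ x).ofLp ⬝ᵥ (T *ᵥ (E.φ x).ofLp) := by
  simp only [dotProduct, Matrix.mulVec]
  exact Finset.measurable_sum _ fun i _ => (measurable_coord E.φ_measurable i).mul
    (Finset.measurable_sum _ fun j _ => (measurable_coord E.φ_measurable j).const_mul _)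

theorem measurable_width (E : Env S A d) (T : Matrix (Fin d) (Fin d) ℝ) :
    Measurable (width E T) :=
  ((measurable_quadForm E T⁻¹).const_mul _).sqrt.min measurable_const

theorem width_nonneg (T : Matrix (Fin d) (Fin d) ℝ) (x : S × A) : 0 ≤ width E T x :=
  le_min (Real.sqrt_nonneg _) zero_le_one

theorem width_le_one (T : Matrix (Fin d) (Fin d) ℝ) (x : S × A) : width E T x ≤ 1 :=
  min_le_right _ _

theorem popCov_succ (ρ : ℕ → Measure (S × A)) (n : ℕ) :
    popCov E ρ (n + 1) = popCov E ρ n + secondMoment E.φ (ρ (n + 1)) := by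
  rw [popCov, Finset.sum_range_succ, ← add_assoc]; rfl

variable {ρ : ℕ → Measure (S × A)} [∀ i, IsProbabilityMeasure (ρ i)]

theorem quadForm_popCov (n : ℕ) (v : Fin d → ℝ) : v ⬝ᵥ (popCov E ρ n *ᵥ v) =
    v ⬝ᵥ v + ∑ i ∈ Finset.range (n + 1), ∫ x, ((E.φ x).ofLp ⬝ᵥ v) ^ 2 ∂ρ i := by
  simp only [popCov, Matrix.add_mulVec, Matrix.one_mulVec, dotProduct_add, Matrix.sum_mulVec,
    dotProduct_sum]
  congr 1
  exact Finset.sum_congr rfl fun i _ => quadForm_secondMoment E.φ_measurable E.φ_norm (ρ i) v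

theorem le_quadForm_popCov (n : ℕ) (v : Fin d → ℝ) : v ⬝ᵥ v ≤ v ⬝ᵥ (popCov E ρ n *ᵥ v) := by
  rw [quadForm_popCov]
  have h : 0 ≤ ∑ i ∈ Finset.range (n + 1), ∫ x, ((E.φ x).ofLp ⬝ᵥ v) ^ 2 ∂ρ i :=
    Finset.sum_nonneg fun i _ => integral_nonneg fun x => sq_nonneg _
  linarith

theorem quadForm_popCov_le (n : ℕ) (v : Fin d → ℝ) :
    v ⬝ᵥ (popCov E ρ n *ᵥ v) ≤ ((n : ℝ) + 2) * (v ⬝ᵥ v) := by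
  rw [quadForm_popCov]
  have h := Finset.sum_le_sum fun i (_ : i ∈ Finset.range (n + 1)) =>
    quadForm_secondMoment_le E.φ_measurable E.φ_norm (ρ i) v
  simp only [quadForm_secondMoment E.φ_measurable E.φ_norm] at h
  simp only [Finset.sum_const, Finset.card_range, nsmul_eq_mul] at h
  push_cast at h
  linarith

theorem popCov_posDef (n : ℕ) : (popCov E ρ n).PosDef :=
  Matrix.PosDef.one.add_posSemidef (Matrix.posSemidef_sum _ fun i _ =>
    secondMoment_posSemidef E.φ_measurable E.φ_norm (ρ i))

/-- Model errors are controlled by the width, for a model that is accurate on the cover. -/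
theorem abs_modelError_le_width (P Q : LinearModel E) (n : ℕ)
    (hQ : ∑ i ∈ Finset.range (n + 1), ∫ x, (1 - P.affinity Q x) ∂ρ i ≤ 1 / 2)
    {V : S → ℝ} (hV : Measurable V) {B : ℝ} (hV0 : ∀ s, 0 ≤ V s) (hVB : ∀ s, V s ≤ B)
    (hB : 0 ≤ B) (x : S × A) :
    |(∫ s, V s ∂Q.kernel x) - ∫ s, V s ∂P.kernel x| ≤ B * width E (popCov E ρ n) x := by
  rw [width, mul_min_of_nonneg _ _ hB, mul_one]
  refine le_min ?_ ?_
  · obtain ⟨θ, hθ, herr⟩ := LinearModel.exists_modelError P Q hV hV0 hVB hB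
    -- The ridge part contributes `‖θ‖² ≤ B² d`, and accuracy on the cover contributes at most `2 B²
    -- · ½ = B²`. This is the origin of `d + 1` in the bonus scale.
    have h1 : θ.ofLp ⬝ᵥ (popCov E ρ n *ᵥ θ.ofLp) ≤ B ^ 2 * (d + 1) := by
      rw [quadForm_popCov, dotProduct_self_eq_norm_sq]
      have h2 : ‖θ‖ ^ 2 ≤ B ^ 2 * d := by
        calc ‖θ‖ ^ 2 ≤ (B * √(d : ℝ)) ^ 2 := pow_le_pow_left₀ (norm_nonneg _) hθ 2
          _ = _ := by rw [mul_pow, Real.sq_sqrt (Nat.cast_nonneg d)]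
      have h3 : ∑ i ∈ Finset.range (n + 1), ∫ x, ((E.φ x).ofLp ⬝ᵥ θ.ofLp) ^ 2 ∂ρ i ≤
          2 * B ^ 2 * ∑ i ∈ Finset.range (n + 1), ∫ x, (1 - P.affinity Q x) ∂ρ i := by
        rw [Finset.mul_sum]
        refine Finset.sum_le_sum fun i _ => ?_
        rw [← integral_const_mul]
        refine integral_mono_of_nonneg (ae_of_all _ fun x => sq_nonneg _) ?_
          (ae_of_all _ fun x => ?_)
        · refine ((integrable_const 1).sub (integrable_of_abs_le (P.measurable_affinity Q) 1
            fun x => ?_)).const_mul _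
          rw [abs_of_nonneg (P.affinity_nonneg Q x)]
          exact P.affinity_le_one Q x
        · simpa [dotProduct_eq_inner] using (herr x).2
      nlinarith [mul_le_mul_of_nonneg_left hQ (show 0 ≤ 2 * B ^ 2 by positivity)]
    rw [(herr x).1, ← Real.sqrt_sq hB, ← Real.sqrt_mul (sq_nonneg B), ← Real.sqrt_sq_eq_abs]
    refine Real.sqrt_le_sqrt ?_
    have h4 := sq_dotProduct_le_of_posDef (popCov_posDef (E := E) (ρ := ρ) n) (E.φ x).ofLp θ.ofLp
    rw [dotProduct_eq_inner] at h4
    have h5 := posSemidef_quadForm_nonneg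
      (popCov_posDef (E := E) (ρ := ρ) n).inv.posSemidef (E.φ x).ofLp
    exact h4.trans ((mul_le_mul_of_nonneg_left h1 h5).trans_eq (by ring))
  · have h1 := integral_mem_Icc (Q.kernel x) hV hV0 hVB
    have h2 := integral_mem_Icc (P.kernel x) hV hV0 hVB
    rw [abs_le]
    constructor <;> linarith

/-- Since `T` dominates the identity, a deviation of `½ ‖v‖²` gives `T ≤ 2 U` and `U ≤ 2 T`, hence
the same for the inverses. The `½` under the root of the bonus turns the second into the upper bound
by `width`, and the first then loses a factor 4 under the root, that is, the factor 2 in front. -/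
theorem width_le_and_le_width {T U : Matrix (Fin d) (Fin d) ℝ} (hT : T.PosDef)
    (hT1 : ∀ v, v ⬝ᵥ v ≤ v ⬝ᵥ (T *ᵥ v)) (hU : U.IsHermitian)
    (hTU : ∀ v, |v ⬝ᵥ (U *ᵥ v) - v ⬝ᵥ (T *ᵥ v)| ≤ 1 / 2 * (v ⬝ᵥ v)) (x : S × A) :
    width E T x ≤ 2 * min (√((d + 1) * (1 / 2 * ((E.φ x).ofLp ⬝ᵥ (U⁻¹ *ᵥ (E.φ x).ofLp))))) 1 ∧
    min (√((d + 1) * (1 / 2 * ((E.φ x).ofLp ⬝ᵥ (U⁻¹ *ᵥ (E.φ x).ofLp))))) 1 ≤ width E T x := by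
  have hvv : ∀ v : Fin d → ℝ, v ≠ 0 → 0 < v ⬝ᵥ v := fun v hv => by
    simpa using Matrix.dotProduct_star_self_pos_iff.2 hv
  have hUp : U.PosDef := by
    refine .of_dotProduct_mulVec_pos hU fun v hv => ?_
    rw [star_trivial]
    linarith [abs_le.1 (hTU v), hT1 v, hvv v hv]
  have hvv0 : ∀ v : Fin d → ℝ, 0 ≤ v ⬝ᵥ v := fun v => by
    rcases eq_or_ne v 0 with h | h
    · simp [h]
    · exact (hvv v h).le
  have h1 := inv_quadForm_le hUp hT (fun v => by
    linarith [abs_le.1 (hTU v), hT1 v, hvv0 v]) (E.φ x).ofLp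
  have h2 := inv_quadForm_le hT hUp (fun v => by
    linarith [abs_le.1 (hTU v), hT1 v, hvv0 v]) (E.φ x).ofLp
  have hd : (0 : ℝ) ≤ d + 1 := by positivity
  have hq := posSemidef_quadForm_nonneg hUp.inv.posSemidef (E.φ x).ofLp
  unfold width
  set a := (E.φ x).ofLp ⬝ᵥ (T⁻¹ *ᵥ (E.φ x).ofLp)
  set b := (E.φ x).ofLp ⬝ᵥ (U⁻¹ *ᵥ (E.φ x).ofLp)
  constructor
  · have h3 : √((d + 1) * a) ≤ 2 * √((d + 1) * (1 / 2 * b)) := by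
      rw [show (2 : ℝ) = √(2 ^ 2) from (Real.sqrt_sq (by norm_num)).symm,
        ← Real.sqrt_mul (by positivity)]
      refine Real.sqrt_le_sqrt ?_
      rw [Real.sqrt_sq (by norm_num)]
      nlinarith [mul_le_mul_of_nonneg_left h1 hd]
    rw [mul_min_of_nonneg _ _ (by norm_num)]
    exact min_le_min h3 (by norm_num)
  · refine min_le_min (Real.sqrt_le_sqrt (mul_le_mul_of_nonneg_left ?_ hd)) le_rfl
    linarith

theorem integral_visitLaw (P : Kernel (S × A) S) [IsMarkovKernel P] (pol : Policy S A)
    {g : S × A → ℝ} (hg : Measurable g) {B : ℝ} (hB : ∀ x, |g x| ≤ B) :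
    ∑ h ∈ Finset.range E.H, ∫ x, g x ∂stepLaw P E.s₀ pol h =
      E.H * ∫ x, g x ∂visitLaw E P pol := by
  have hH : (E.H : ℝ) ≠ 0 := by exact_mod_cast E.H_pos.ne'
  rw [visitLaw, integral_smul_measure, integral_finsetSum_measure fun h _ =>
    integrable_of_abs_le hg B hB]
  simp [mul_inv_cancel_left₀ hH]

theorem J_add (P : Kernel (S × A) S) [IsMarkovKernel P] (pol : Policy S A) {f g : S × A → ℝ}
    (hf : Measurable f) (hg : Measurable g) {B : ℝ} (hfB : ∀ x, |f x| ≤ B) (hgB : ∀ x, |g x| ≤ B) :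
    J E pol (fun x => f x + g x) P = J E pol f P + J E pol g P := by
  unfold J
  rw [← Finset.sum_add_distrib]
  exact Finset.sum_congr rfl fun _ _ => integral_add (integrable_of_abs_le hf B hfB)
    (integrable_of_abs_le hg B hgB)

theorem J_mem_Icc (P : Kernel (S × A) S) [IsMarkovKernel P] (pol : Policy S A) :
    0 ≤ J E pol E.r P ∧ J E pol E.r P ≤ E.H := by
  have h := fun h => integral_mem_Icc (stepLaw P E.s₀ pol h) E.r_measurable
    (fun x => (E.r_mem x).1) (fun x => (E.r_mem x).2)
  refine ⟨Finset.sum_nonneg fun i _ => (h i).1, ?_⟩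
  exact (Finset.sum_le_sum fun i _ => (h i).2).trans_eq (by simp)

/-- Suboptimality of a policy that is optimal for the fitted model with an optimistic bonus. -/
theorem J_sub_J_le_integral_width (P Q : LinearModel E) (pol pol' : Policy S A)
    {b g : S × A → ℝ} (hb : Measurable b) (hg : Measurable g) (hg0 : ∀ x, 0 ≤ g x)
    (hg1 : ∀ x, g x ≤ 1) (hgb : ∀ x, E.H * g x ≤ b x) (hbg : ∀ x, b x ≤ 2 * E.H * g x)
    (herr : ∀ (V : S → ℝ) (B : ℝ), Measurable V → 0 ≤ B → (∀ s, 0 ≤ V s) → (∀ s, V s ≤ B) →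
      ∀ x, |(∫ s, V s ∂Q.kernel x) - ∫ s, V s ∂P.kernel x| ≤ B * g x)
    (hplan : J E pol (fun x => E.r x + b x) Q.kernel ≤ J E pol' (fun x => E.r x + b x) Q.kernel) :
    J E pol E.r P.kernel - J E pol' E.r P.kernel ≤
      3 * (E.H : ℝ) ^ 3 * ∫ x, g x ∂visitLaw E P.kernel pol' := by
  have hH1 : (1 : ℝ) ≤ E.H := by exact_mod_cast E.H_pos
  have hH0 : (0 : ℝ) ≤ E.H := by linarith
  have hr0 : ∀ x, 0 ≤ E.r x := fun x => (E.r_mem x).1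
  have hr1 : ∀ x, E.r x ≤ 1 := fun x => (E.r_mem x).2
  have hb0 : ∀ x, 0 ≤ b x := fun x => (mul_nonneg hH0 (hg0 x)).trans (hgb x)
  have hb2 : ∀ x, b x ≤ 2 * E.H := fun x => (hbg x).trans (by nlinarith [hg1 x])
  have hrb : Measurable fun x => E.r x + b x := E.r_measurable.add hb
  have hgabs : ∀ x, |g x| ≤ 1 := fun x => by rw [abs_of_nonneg (hg0 x)]; exact hg1 x
  have hrabs : ∀ x, |E.r x| ≤ 2 * E.H := fun x => by
    rw [abs_of_nonneg (hr0 x)]; linarith [hr1 x]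
  have hbabs : ∀ x, |b x| ≤ 2 * E.H := fun x => by rw [abs_of_nonneg (hb0 x)]; exact hb2 x
  -- optimism
  have hopt : J E pol E.r P.kernel ≤ J E pol (fun x => E.r x + b x) Q.kernel := by
    rw [J_eq_J_add_sum P.kernel pol Q.kernel E.r_measurable hr0 hr1, J_add Q.kernel pol
      E.r_measurable hb hrabs hbabs, J, J]
    refine add_le_add_right (Finset.sum_le_sum fun h hh => ?_) _
    have hVm := measurable_value P.kernel pol E.r_measurable (E.H - 1 - h) (h + 1)
    have hVI := value_mem_Icc P.kernel pol E.r_measurable hr0 hr1 (E.H - 1 - h) (h + 1)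
    have hk : ((E.H - 1 - h : ℕ) : ℝ) ≤ E.H := by exact_mod_cast (by omega : E.H - 1 - h ≤ E.H)
    have hm : ∀ U : LinearModel E, Measurable fun x =>
        ∫ s, value P.kernel pol E.r (E.H - 1 - h) (h + 1) s ∂U.kernel x :=
      fun U => measurable_integral_kernel U.kernel hVm
    have hle := fun x => herr _ (E.H : ℝ) hVm hH0 (fun s => (hVI s).1)
      (fun s => (hVI s).2.trans (by linarith)) x
    refine integral_mono (integrable_of_abs_le ((hm P).sub (hm Q)) (E.H : ℝ) fun x => ?_)
      (integrable_of_abs_le hb _ hbabs) fun x => ?_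
    · rw [abs_sub_comm]
      exact (hle x).trans (by nlinarith [hg1 x])
    · have := abs_le.1 (hle x)
      exact le_trans (by linarith) (hgb x)
  -- The planned value is compared with the true one along true trajectories of `pol'`, so that the
  -- widths are averaged over its own visitation law.
  have hgap : J E pol' (fun x => E.r x + b x) Q.kernel ≤ J E pol' E.r P.kernel +
      3 * (E.H : ℝ) ^ 3 * ∫ x, g x ∂visitLaw E P.kernel pol' := by
    have hc : ∀ x, E.r x + b x ≤ 2 * E.H + 1 := fun x => by linarith [hr1 x, hb2 x]
    have h0 : ∀ x, 0 ≤ E.r x + b x := fun x => add_nonneg (hr0 x) (hb0 x)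
    rw [J_eq_J_add_sum Q.kernel pol' P.kernel hrb h0 hc, J_add P.kernel pol'
      E.r_measurable hb hrabs hbabs, add_assoc]
    refine add_le_add_right ?_ _
    have hB : ∀ h ∈ Finset.range E.H, (∫ x, b x ∂stepLaw P.kernel E.s₀ pol' h) +
        ∫ x, ((∫ s, value Q.kernel pol' (fun x => E.r x + b x) (E.H - 1 - h) (h + 1) s ∂Q.kernel x) -
          ∫ s, value Q.kernel pol' (fun x => E.r x + b x) (E.H - 1 - h) (h + 1) s ∂P.kernel x)
          ∂stepLaw P.kernel E.s₀ pol' h ≤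
        3 * (E.H : ℝ) ^ 2 * ∫ x, g x ∂stepLaw P.kernel E.s₀ pol' h := by
      intro h hh
      have hVm := measurable_value Q.kernel pol' hrb (E.H - 1 - h) (h + 1)
      have hVI := value_mem_Icc Q.kernel pol' hrb h0 hc (E.H - 1 - h) (h + 1)
      have hk : ((E.H - 1 - h : ℕ) : ℝ) ≤ E.H - 1 := by
        have h2 : E.H - 1 - h + 1 ≤ E.H := by have := E.H_pos; omega
        have : ((E.H - 1 - h : ℕ) : ℝ) + 1 ≤ E.H := by exact_mod_cast h2
        linarith
      have hm : ∀ U : LinearModel E, Measurable fun x => ∫ s, value Q.kernel pol'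
          (fun x => E.r x + b x) (E.H - 1 - h) (h + 1) s ∂U.kernel x :=
        fun U => measurable_integral_kernel U.kernel hVm
      -- After step `h` at most `H - 1` steps remain, each with reward at most `2 H + 1`. Adding the
      -- bonus gives `2 H + B ≤ 3 H²`, and the sum over the steps supplies the third factor `H`.
      set B : ℝ := (E.H - 1) * (2 * E.H + 1)
      have hB0 : 0 ≤ B := mul_nonneg (by linarith) (by linarith)
      have hle := fun x => herr _ B hVm hB0 (fun s => (hVI s).1)
        (fun s => (hVI s).2.trans (mul_le_mul_of_nonneg_right hk (by linarith))) x
      have hid : Integrable (fun x => (∫ s, value Q.kernel pol' (fun x => E.r x + b x)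
          (E.H - 1 - h) (h + 1) s ∂Q.kernel x) - ∫ s, value Q.kernel pol' (fun x => E.r x + b x)
          (E.H - 1 - h) (h + 1) s ∂P.kernel x) (stepLaw P.kernel E.s₀ pol' h) :=
        integrable_of_abs_le ((hm Q).sub (hm P)) B fun x => (hle x).trans (by nlinarith [hg1 x])
      have hib := integrable_of_abs_le (ρ := stepLaw P.kernel E.s₀ pol' h) hb _ hbabs
      have hig := integrable_of_abs_le (ρ := stepLaw P.kernel E.s₀ pol' h) hg _ hgabs
      rw [← integral_add hib hid, ← integral_const_mul]
      refine integral_mono (hib.add hid) (hig.const_mul _) fun x => ?_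
      have h1 := (abs_le.1 (hle x)).2
      calc _ ≤ 2 * E.H * g x + B * g x := add_le_add (hbg x) h1
        _ = (2 * E.H + B) * g x := by ring
        _ ≤ 3 * (E.H : ℝ) ^ 2 * g x :=
          mul_le_mul_of_nonneg_right (by simp only [B]; nlinarith) (hg0 x)
    have := Finset.sum_le_sum hB
    rw [Finset.sum_add_distrib, ← Finset.mul_sum, integral_visitLaw P.kernel pol' hg hgabs] at this
    rw [J]
    exact this.trans_eq (by ring)
  linarith

theorem sq_integral_le_integral_sq {X : Type*} [MeasurableSpace X] (μ : Measure X)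
    [IsProbabilityMeasure μ] {f : X → ℝ} (hf : Measurable f) {B : ℝ} (hB : ∀ x, |f x| ≤ B) :
    (∫ x, f x ∂μ) ^ 2 ≤ ∫ x, f x ^ 2 ∂μ := by
  have hi := integrable_of_abs_le (ρ := μ) hf B hB
  have hi2 := integrable_of_abs_le (ρ := μ) (hf.pow_const 2) (B ^ 2) fun x => by
    rw [abs_pow]; exact pow_le_pow_left₀ (abs_nonneg _) (hB x) 2
  set m := ∫ x, f x ∂μ
  have h0 : 0 ≤ ∫ x, (f x ^ 2 - 2 * m * f x + m ^ 2) ∂μ :=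
    integral_nonneg fun x => by
      change 0 ≤ f x ^ 2 - 2 * m * f x + m ^ 2
      nlinarith [sq_nonneg (f x - m)]
  have hi3 : Integrable (fun x => f x ^ 2 - 2 * m * f x) μ := hi2.sub (hi.const_mul (2 * m))
  rw [integral_add hi3 (integrable_const _), integral_sub hi2 (hi.const_mul (2 * m)),
    integral_const_mul] at h0
  simp only [integral_const, probReal_univ, one_smul] at h0
  nlinarith

/-- Cauchy–Schwarz over the episodes and Jensen within each reduce the sum to the elliptic potential
lemma. The covariance with index `k` contains `ρ 0, …, ρ k` and is tested against the next law `ρ (k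
+ 1)`, which is exactly the update to index `k + 1`. -/
theorem sum_integral_width_le (m : ℕ) :
    (∑ k ∈ Finset.range m, ∫ x, width E (popCov E ρ k) x ∂ρ (k + 1)) ^ 2 ≤
      m * ((d + 1) * (2 * (d * Real.log (m + 2)))) := by
  have htr : ∀ k, ((popCov E ρ k)⁻¹ * secondMoment E.φ (ρ (k + 1))).trace =
      ∫ x, (E.φ x).ofLp ⬝ᵥ ((popCov E ρ k)⁻¹ *ᵥ (E.φ x).ofLp) ∂ρ (k + 1) := fun k =>
    trace_mul_secondMoment E.φ_measurable E.φ_norm _ _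
  have hq0 : ∀ k x, 0 ≤ (E.φ x).ofLp ⬝ᵥ ((popCov E ρ k)⁻¹ *ᵥ (E.φ x).ofLp) := fun k x =>
    posSemidef_quadForm_nonneg (popCov_posDef k).inv.posSemidef _
  -- For `w = Σ⁻¹ φ` and `q = φ · w`: `‖w‖² ≤ w · Σ w = q` because `Σ` dominates the identity, and
  -- `q² ≤ ‖w‖²` because `‖φ‖ ≤ 1`; hence `q ≤ 1`.
  have hq1 : ∀ k x, (E.φ x).ofLp ⬝ᵥ ((popCov E ρ k)⁻¹ *ᵥ (E.φ x).ofLp) ≤ 1 := by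
    intro k x
    set u := (E.φ x).ofLp with hu
    set w := (popCov E ρ k)⁻¹ *ᵥ u with hw
    have h1 := le_quadForm_popCov (E := E) (ρ := ρ) k w
    rw [hw, mulVec_inv_mulVec (popCov_posDef k), ← hw] at h1
    have h2 := sq_dotProduct_le E.φ_norm x w
    rw [dotProduct_comm w u] at h1
    have h3 := hq0 k x
    rw [← hu] at h2 h3
    rw [← hw] at h3
    nlinarith
  have hmq := fun k => measurable_quadForm E (popCov E ρ k)⁻¹
  have hsum := sum_trace_inv_mul_le (T := popCov E ρ) (G := fun k => secondMoment E.φ (ρ (k + 1)))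
    popCov_posDef (fun k => secondMoment_posSemidef E.φ_measurable E.φ_norm _) (popCov_succ ρ)
    (fun k => by rw [htr]; exact (integral_mem_Icc _ (hmq k) (hq0 k) (hq1 k)).1)
    (fun k => by rw [htr]; exact (integral_mem_Icc _ (hmq k) (hq0 k) (hq1 k)).2)
    (by
      have h := secondMoment_posSemidef E.φ_measurable E.φ_norm (ρ 0)
      have h1 := one_add_trace_le_det h
      have h2 := h.trace_nonneg
      have : popCov E ρ 0 = 1 + secondMoment E.φ (ρ 0) := by simp [popCov]
      rw [this]; linarith) m (quadForm_popCov_le m)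
  have hw2 : ∀ k, (∫ x, width E (popCov E ρ k) x ∂ρ (k + 1)) ^ 2 ≤
      (d + 1) * ((popCov E ρ k)⁻¹ * secondMoment E.φ (ρ (k + 1))).trace := by
    intro k
    rw [htr, ← integral_const_mul]
    refine (sq_integral_le_integral_sq _ (measurable_width E _) (B := 1) fun x => ?_).trans ?_
    · rw [abs_of_nonneg (width_nonneg _ x)]; exact width_le_one _ x
    · refine integral_mono_of_nonneg (ae_of_all _ fun x => sq_nonneg _)
        (integrable_of_abs_le ((hmq k).const_mul _) (d + 1) fun x => ?_) (ae_of_all _ fun x => ?_)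
      · rw [abs_of_nonneg (mul_nonneg (by positivity) (hq0 k x))]
        exact mul_le_of_le_one_right (by positivity) (hq1 k x)
      · change width E (popCov E ρ k) x ^ 2 ≤ _
        calc _ ≤ (√(((d : ℝ) + 1) * ((E.φ x).ofLp ⬝ᵥ ((popCov E ρ k)⁻¹ *ᵥ (E.φ x).ofLp)))) ^ 2 :=
              pow_le_pow_left₀ (width_nonneg _ x) (min_le_left _ _) 2
          _ = _ := Real.sq_sqrt (mul_nonneg (by positivity) (hq0 k x))
  calc _ ≤ (m : ℝ) * ∑ k ∈ Finset.range m, (∫ x, width E (popCov E ρ k) x ∂ρ (k + 1)) ^ 2 := by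
        simpa using sq_sum_le_card_mul_sum_sq (s := Finset.range m)
          (f := fun k => ∫ x, width E (popCov E ρ k) x ∂ρ (k + 1))
    _ ≤ (m : ℝ) * ∑ k ∈ Finset.range m,
          ((d + 1) * ((popCov E ρ k)⁻¹ * secondMoment E.φ (ρ (k + 1))).trace) :=
        mul_le_mul_of_nonneg_left (Finset.sum_le_sum fun k _ => hw2 k) (Nat.cast_nonneg m)
    _ ≤ _ := by
        rw [← Finset.mul_sum]
        refine mul_le_mul_of_nonneg_left (mul_le_mul_of_nonneg_left ?_ (by positivity))
          (Nat.cast_nonneg m)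
        simpa using hsum

end Regret

/-! ### Concentration of empirical covariances. -/

section Concentration

variable {S A : Type*} [MeasurableSpace S] [MeasurableSpace A] {d : ℕ}

/-- The matrix `v vᵀ` as a vector of the Euclidean space of matrices. -/
noncomputable def outerVec (v : Fin d → ℝ) : EuclideanSpace ℝ (Fin d × Fin d) :=
  WithLp.toLp 2 fun ij => v ij.1 * v ij.2

/-- Quadratic forms in `φ` become linear functionals of `φ φᵀ`. -/
theorem inner_outerVec (v w : Fin d → ℝ) : inner ℝ (outerVec v) (outerVec w) = (v ⬝ᵥ w) ^ 2 := by
  rw [EuclideanSpace.inner_eq_star_dotProduct, star_trivial]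
  simp only [outerVec, dotProduct, Fintype.sum_prod_type, sq, Finset.sum_mul_sum]
  exact Finset.sum_congr rfl fun i _ => Finset.sum_congr rfl fun j _ => by ring

theorem norm_outerVec (v : Fin d → ℝ) : ‖outerVec v‖ = v ⬝ᵥ v := by
  have h0 : 0 ≤ v ⬝ᵥ v := Finset.sum_nonneg fun i _ => mul_self_nonneg _
  have h := inner_outerVec v v
  rw [real_inner_self_eq_norm_sq] at h
  exact (sq_eq_sq₀ (norm_nonneg _) h0).1 h

/-- The feature map `x ↦ φ(x) φ(x)ᵀ`. -/
noncomputable def outerFeature (E : Env S A d) (x : S × A) : EuclideanSpace ℝ (Fin d × Fin d) :=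
  outerVec (E.φ x).ofLp

theorem measurable_outerFeature (E : Env S A d) : Measurable (outerFeature E) := by
  refine (WithLp.measurable_toLp 2 _).comp (measurable_pi_lambda _ fun ij => ?_)
  exact (measurable_coord E.φ_measurable ij.1).mul (measurable_coord E.φ_measurable ij.2)

theorem norm_outerFeature_le (E : Env S A d) (x : S × A) : ‖outerFeature E x‖ ≤ 1 := by
  rw [outerFeature, norm_outerVec, dotProduct_self_eq_norm_sq]
  exact pow_le_one₀ (norm_nonneg _) (E.φ_norm x)

theorem integrable_outerFeature (E : Env S A d) (ρ : Measure (S × A)) [IsFiniteMeasure ρ] :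
    Integrable (outerFeature E) ρ :=
  Integrable.of_bound (measurable_outerFeature E).aestronglyMeasurable 1
    (ae_of_all _ (norm_outerFeature_le E))

theorem measure_outerFeature_deviation_le (E : Env S A d) (ρ : Measure (S × A))
    [IsProbabilityMeasure ρ] (K : ℕ) {t : ℝ} (ht : 0 < t) :
    (Measure.pi fun _ : Fin K => ρ)
      {y | K * t ≤ ‖∑ j, outerFeature E (y j) - (K : ℝ) • ∫ x, outerFeature E x ∂ρ‖} ≤
      ENNReal.ofReal (2 * Real.exp (-(K * t ^ 2 / 8))) := by
  set m := ∫ x, outerFeature E x ∂ρ with hm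
  have hmn : ‖m‖ ≤ 1 := by
    simpa using norm_integral_le_of_norm_le_const (μ := ρ)
      (ae_of_all _ (norm_outerFeature_le E))
  -- Centring a vector of norm at most 1 gives the bound 2, and thus the exponent denominator `2 ·
  -- 2² = 8`.
  have h := measureReal_norm_sum_ge_le (ρ := ρ) (Y := fun x => outerFeature E x - m)
    ((measurable_outerFeature E).sub_const m) (b := 2) (by norm_num)
    (fun x => (norm_sub_le _ _).trans (by linarith [norm_outerFeature_le E x]))
    (by rw [integral_sub (integrable_outerFeature E ρ) (integrable_const _)]; simp [← hm]) K ht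
  rw [← ofReal_measureReal]
  refine ENNReal.ofReal_le_ofReal ?_
  simp only [Finset.sum_sub_distrib, Finset.sum_const, Finset.card_univ, Fintype.card_fin,
    ← Nat.cast_smul_eq_nsmul ℝ] at h
  refine h.trans_eq ?_
  norm_num

/-- Cauchy–Schwarz against `v vᵀ`: one deviation in the Frobenius norm controls all directions at
once, without a net over `v`. -/
theorem quadForm_deviation_le (E : Env S A d) (ρ : Measure (S × A)) [IsProbabilityMeasure ρ]
    {K : ℕ} (hK : 0 < K) {t : ℝ} {y : Fin K → S × A}
    (h : ‖∑ j, outerFeature E (y j) - (K : ℝ) • ∫ x, outerFeature E x ∂ρ‖ ≤ K * t)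
    (v : Fin d → ℝ) :
    |(K : ℝ)⁻¹ * ∑ j, ((E.φ (y j)).ofLp ⬝ᵥ v) ^ 2 - ∫ x, ((E.φ x).ofLp ⬝ᵥ v) ^ 2 ∂ρ| ≤
      t * (v ⬝ᵥ v) := by
  have hK' : (0 : ℝ) < K := by exact_mod_cast hK
  have h1 := (abs_real_inner_le_norm (outerVec v)
    (∑ j, outerFeature E (y j) - (K : ℝ) • ∫ x, outerFeature E x ∂ρ)).trans
    (mul_le_mul_of_nonneg_left h (norm_nonneg _))
  rw [inner_sub_right, inner_sum, inner_smul_right,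
    ← integral_inner (integrable_outerFeature E ρ), norm_outerVec] at h1
  simp only [outerFeature, inner_outerVec, dotProduct_comm v (WithLp.ofLp _)] at h1
  have h2 : (K : ℝ)⁻¹ * ∑ j, ((E.φ (y j)).ofLp ⬝ᵥ v) ^ 2 - ∫ x, ((E.φ x).ofLp ⬝ᵥ v) ^ 2 ∂ρ =
      (K : ℝ)⁻¹ * (∑ j, ((E.φ (y j)).ofLp ⬝ᵥ v) ^ 2 - K * ∫ x, ((E.φ x).ofLp ⬝ᵥ v) ^ 2 ∂ρ) := by
    field_simp
  rw [h2, abs_mul, abs_of_pos (inv_pos.2 hK'), inv_mul_le_iff₀ hK']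
  linarith

end Concentration

/-! ### Failure events along an adaptive run. -/

section Run

variable {S A : Type*} [MeasurableSpace S] [MeasurableSpace A] {d : ℕ} {E : Env S A d}
  {Mods : Finset (LinearModel E)} {Pol : Set (Policy S A)} {p : HyperParams}

theorem measurable_prefixHist {n i : ℕ} (hi : i ≤ n) :
    Measurable (prefixHist hi : (Fin n → Batch S A p) → Fin i → Batch S A p) :=
  measurable_pi_lambda _ fun _ => measurable_pi_apply _

namespace Alg

/-- Union bound over the episodes of a run. -/
theorem runLaw_exists_mem_le (alg : Alg E Mods Pol p) (P : LinearModel E)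
    (Bad : ∀ n, Set ((Fin n → Batch S A p) × Batch S A p)) (hBad : ∀ n, MeasurableSet (Bad n))
    {q : ℝ≥0∞} (hq : ∀ n hist, alg.batchLaw P n hist {b | (hist, b) ∈ Bad n} ≤ q) (m : ℕ) :
    alg.runLaw P m {hist | ∃ n : Fin m, (prefixHist n.2.le hist, hist n) ∈ Bad n} ≤ m * q := by
  have hmeas : ∀ m, MeasurableSet {hist : Fin m → Batch S A p |
      ∃ n : Fin m, (prefixHist n.2.le hist, hist n) ∈ Bad n} := by
    intro m
    have : {hist : Fin m → Batch S A p | ∃ n : Fin m, (prefixHist n.2.le hist, hist n) ∈ Bad n} =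
        ⋃ n : Fin m, (fun hist => (prefixHist n.2.le hist, hist n)) ⁻¹' Bad n := by
      ext hist; simp
    rw [this]
    exact MeasurableSet.iUnion fun n =>
      ((measurable_prefixHist n.2.le).prodMk (measurable_pi_apply n)) (hBad n)
  induction m with
  | zero => simp
  | succ m ih =>
    rw [runLaw, Measure.map_apply (measurable_snoc m) (hmeas _)]
    have hsub : (fun q : (Fin m → Batch S A p) × Batch S A p =>
        (Fin.snoc (α := fun _ => Batch S A p) q.1 q.2 : Fin (m + 1) → Batch S A p)) ⁻¹'
        {hist | ∃ n : Fin (m + 1), (prefixHist n.2.le hist, hist n) ∈ Bad n} ⊆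
        Prod.fst ⁻¹' {hist | ∃ n : Fin m, (prefixHist n.2.le hist, hist n) ∈ Bad n} ∪ Bad m := by
      rintro ⟨hist, b⟩ ⟨n, hn⟩
      have hpre : ∀ (k : ℕ) (hk : k ≤ m + 1) (hk' : k ≤ m),
          prefixHist hk (Fin.snoc (α := fun _ => Batch S A p) hist b) = prefixHist hk' hist := by
        intro k hk hk'
        funext j
        exact Fin.snoc_castSucc (α := fun _ => Batch S A p) b hist (Fin.castLE hk' j)
      induction n using Fin.lastCases with
      | last =>
        right
        simp only [Fin.snoc_last] at hn
        rw [hpre _ _ le_rfl] at hn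
        exact hn
      | cast n =>
        left
        refine ⟨n, ?_⟩
        simp only [Fin.snoc_castSucc] at hn
        rw [hpre _ _ n.2.le] at hn
        exact hn
    refine (measure_mono hsub).trans ((measure_union_le _ _).trans ?_)
    have h1 : (alg.runLaw P m ⊗ₘ alg.batchKernel P m)
        (Prod.fst ⁻¹' {hist | ∃ n : Fin m, (prefixHist n.2.le hist, hist n) ∈ Bad n}) ≤ m * q := by
      rw [← Measure.map_apply measurable_fst (hmeas m)]
      change (alg.runLaw P m ⊗ₘ alg.batchKernel P m).fst _ ≤ _
      rw [Measure.fst_compProd]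
      exact ih
    -- Given the past, the new batch has law `batchLaw`, so the conditional bound integrates to the
    -- same bound.
    have h2 : (alg.runLaw P m ⊗ₘ alg.batchKernel P m) (Bad m) ≤ q := by
      rw [Measure.compProd_apply (hBad m)]
      calc _ ≤ ∫⁻ _, q ∂alg.runLaw P m := lintegral_mono fun hist => hq m hist
        _ = q := by simp
    calc _ ≤ m * q + q := add_le_add h1 h2
      _ = _ := by push_cast; ring

/-- The empirical second moment of episode `n` deviates by at least `t`. -/
def covBad (alg : Alg E Mods Pol p) (P : LinearModel E) (t : ℝ) (n : ℕ) :
    Set ((Fin n → Batch S A p) × Batch S A p) :=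
  {z | p.K * t ≤ ‖∑ j, outerFeature E (z.2.1 j) -
    (p.K : ℝ) • ∫ x, outerFeature E x ∂visitLaw E P.kernel (alg.policy n z.1)‖}

/-- The model `Q` is far from `P` on the cover of episode `n` but at least as likely. -/
def mleBad (alg : Alg E Mods Pol p) (P Q : LinearModel E) (τ : ℝ) (n : ℕ) :
    Set ((Fin n → Batch S A p) × Batch S A p) :=
  {z | τ ≤ 1 - ∫ x, P.affinity Q x ∂alg.coverLaw P n z.1} ∩ {z | logLik P z.2 ≤ logLik Q z.2}

theorem measurableSet_covBad (alg : Alg E Mods Pol p) (P : LinearModel E) (t : ℝ) (n : ℕ) :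
    MeasurableSet (alg.covBad P t n) := by
  let κ : Kernel (Fin n → Batch S A p) (S × A) :=
    ⟨_, measurable_visitLaw_sect E P.kernel (alg.act n)⟩
  have h1 : Measurable fun hist => ∫ x, outerFeature E x ∂κ hist :=
    (measurable_outerFeature E).stronglyMeasurable.integral_kernel.measurable
  have h2 : Measurable fun z : (Fin n → Batch S A p) × Batch S A p =>
      ∑ j, outerFeature E (z.2.1 j) :=
    Finset.measurable_sum _ fun j _ => (measurable_outerFeature E).comp
      ((measurable_pi_apply j).comp (measurable_fst.comp measurable_snd))
  exact measurableSet_le measurable_const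
    (h2.sub ((h1.comp measurable_fst).const_smul (p.K : ℝ))).norm

theorem measurableSet_mleBad (alg : Alg E Mods Pol p) (P Q : LinearModel E) (τ : ℝ) (n : ℕ) :
    MeasurableSet (alg.mleBad P Q τ n) := by
  let κ : Kernel (Fin n → Batch S A p) (S × A) := ⟨_, alg.measurable_coverLaw P n⟩
  have h1 : Measurable fun hist => ∫ x, P.affinity Q x ∂κ hist :=
    measurable_integral_kernel κ (P.measurable_affinity Q)
  exact (measurableSet_le measurable_const ((h1.comp measurable_fst).const_sub 1)).inter
    (measurable_snd (measurableSet_logLik_le P Q))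

theorem batchLaw_covBad_le (alg : Alg E Mods Pol p) (P : LinearModel E) {t : ℝ} (ht : 0 < t) (n : ℕ)
    (hist : Fin n → Batch S A p) : alg.batchLaw P n hist {b | (hist, b) ∈ alg.covBad P t n} ≤
      ENNReal.ofReal (2 * Real.exp (-(p.K * t ^ 2 / 8))) := by
  have : IsProbabilityMeasure (visitLaw E P.kernel (alg.policy n hist)) := inferInstance
  have h : {b : Batch S A p | (hist, b) ∈ alg.covBad P t n} = {y | p.K * t ≤
      ‖∑ j, outerFeature E (y j) -
        (p.K : ℝ) • ∫ x, outerFeature E x ∂visitLaw E P.kernel (alg.policy n hist)‖} ×ˢ Set.univ := by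
    ext b; simp [covBad]
  rw [h, batchLaw, Measure.prod_prod, measure_univ, mul_one]
  exact measure_outerFeature_deviation_le E _ p.K ht

/-- Given the past, the cover law is fixed: either `Q` is close to `P` on it and the event is empty,
or the Chernoff bound applies. -/
theorem batchLaw_mleBad_le (alg : Alg E Mods Pol p) (P Q : LinearModel E) (τ : ℝ) (n : ℕ)
    (hist : Fin n → Batch S A p) : alg.batchLaw P n hist {b | (hist, b) ∈ alg.mleBad P Q τ n} ≤
      ENNReal.ofReal (Real.exp (-(p.M * τ))) := by
  by_cases hτ : τ ≤ 1 - ∫ x, P.affinity Q x ∂alg.coverLaw P n hist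
  · have h : {b : Batch S A p | (hist, b) ∈ alg.mleBad P Q τ n} = Set.univ ×ˢ
        {y | ∏ i, P.density (y i).1 (y i).2 ≤ ∏ i, Q.density (y i).1 (y i).2} := by
      ext b
      simp [mleBad, hτ, logLik_le_logLik_iff]
    rw [h, batchLaw, Measure.prod_prod, measure_univ, one_mul]
    exact measure_prod_density_le_exp P Q _ p.M hτ
  · have h : {b : Batch S A p | (hist, b) ∈ alg.mleBad P Q τ n} = ∅ := by
      ext b
      simp [mleBad, hτ]
    rw [h, measure_empty]
    exact zero_le

/-- The run is good: covariances and models of all episodes are accurate. -/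
def goodRun (alg : Alg E Mods Pol p) (P : LinearModel E) (t τ : ℝ) : Set (Fin p.N → Batch S A p) :=
  {hist | ∀ n : Fin p.N, (prefixHist n.2.le hist, hist n) ∉ alg.covBad P t n ∧
    ∀ Q ∈ Mods, (prefixHist n.2.le hist, hist n) ∉ alg.mleBad P Q τ n}

/-- The bad events are indexed by fixed models `Q`, not by the fitted one, so the likelihood
maximizer need not be chosen measurably. -/
theorem runLaw_goodRun_compl_le (alg : Alg E Mods Pol p) (P : LinearModel E) {t τ : ℝ}
    (ht : 0 < t) : alg.runLaw P p.N (alg.goodRun P t τ)ᶜ ≤ ENNReal.ofReal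
      (p.N * (2 * Real.exp (-(p.K * t ^ 2 / 8)) + Mods.card * Real.exp (-(p.M * τ)))) := by
  have h := alg.runLaw_exists_mem_le P
    (fun n => alg.covBad P t n ∪ ⋃ Q ∈ Mods, alg.mleBad P Q τ n)
    (fun n => (alg.measurableSet_covBad P t n).union
      (Finset.measurableSet_biUnion _ fun Q _ => alg.measurableSet_mleBad P Q τ n))
    (q := ENNReal.ofReal (2 * Real.exp (-(p.K * t ^ 2 / 8)) + Mods.card * Real.exp (-(p.M * τ))))
    (fun n hist => ?_) p.N
  · rw [ENNReal.ofReal_mul (Nat.cast_nonneg _), ENNReal.ofReal_natCast]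
    refine (measure_mono fun hist hh => ?_).trans h
    simp only [goodRun, Set.mem_compl_iff, Set.mem_ofPred_eq, not_forall] at hh
    obtain ⟨n, hn⟩ := hh
    refine ⟨n, ?_⟩
    by_contra hc
    refine hn ⟨fun hc1 => hc (Or.inl hc1), fun Q hQ hc2 => hc (Or.inr ?_)⟩
    exact Set.mem_biUnion hQ hc2
  · have hsub : {b : Batch S A p | (hist, b) ∈ alg.covBad P t n ∪ ⋃ Q ∈ Mods, alg.mleBad P Q τ n} =
        {b | (hist, b) ∈ alg.covBad P t n} ∪ ⋃ Q ∈ Mods, {b | (hist, b) ∈ alg.mleBad P Q τ n} := by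
      ext b; simp
    rw [hsub]
    refine (measure_union_le _ _).trans ?_
    rw [ENNReal.ofReal_add (by positivity) (by positivity)]
    refine add_le_add (alg.batchLaw_covBad_le P ht n hist) ?_
    refine (measure_biUnion_finset_le _ _).trans ?_
    refine (Finset.sum_le_sum fun Q _ => alg.batchLaw_mleBad_le P Q τ n hist).trans_eq ?_
    rw [Finset.sum_const, nsmul_eq_mul, ENNReal.ofReal_mul (Nat.cast_nonneg _),
      ENNReal.ofReal_natCast]

end Alg

end Run

/-! ### Deterministic consequences of a good run. -/

section GoodRun

variable {S A : Type*} [MeasurableSpace S] [MeasurableSpace A] {d : ℕ} {E : Env S A d}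
  {Mods : Finset (LinearModel E)} {Pol : Set (Policy S A)} {p : HyperParams}

theorem quadForm_empCov (hlam : p.lam = 1) {n : ℕ} (hist : Fin n → Batch S A p) (v : Fin d → ℝ) :
    v ⬝ᵥ (empCov E p hist *ᵥ v) =
      v ⬝ᵥ v + ∑ i, (p.K : ℝ)⁻¹ * ∑ j, ((E.φ ((hist i).1 j)).ofLp ⬝ᵥ v) ^ 2 := by
  simp only [empCov, hlam, one_smul, Matrix.add_mulVec, Matrix.one_mulVec, dotProduct_add,
    Matrix.sum_mulVec, dotProduct_sum, Matrix.smul_mulVec, dotProduct_smul, smul_eq_mul,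
    Matrix.vecMulVec_mulVec]
  rw [add_comm]
  congr 1
  refine Finset.sum_congr rfl fun i _ => ?_
  congr 1
  refine Finset.sum_congr rfl fun j _ => ?_
  simp [dotProduct_comm v, sq]

theorem empCov_isHermitian {n : ℕ} (hist : Fin n → Batch S A p) :
    (empCov E p hist).IsHermitian := by
  ext i j
  simp [empCov, Matrix.sum_apply, Matrix.vecMulVec_apply, Matrix.one_apply, mul_comm, eq_comm]

theorem bonus_eq (hc : p.c = (E.H : ℝ) * √((d : ℝ) + 1)) {n : ℕ} (hist : Fin n → Batch S A p)
    (x : S × A) : bonus E p hist x = 2 * (E.H : ℝ) * min (√(((d : ℝ) + 1) *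
      (1 / 2 * ((E.φ x).ofLp ⬝ᵥ ((empCov E p hist)⁻¹ *ᵥ (E.φ x).ofLp))))) 1 := by
  rw [bonus, hc, mul_assoc (E.H : ℝ), ← Real.sqrt_mul (by positivity), mul_assoc,
    mul_min_of_nonneg _ _ (Nat.cast_nonneg E.H), mul_one]

theorem measurable_bonus (E : Env S A d) {n : ℕ} (hist : Fin n → Batch S A p) :
    Measurable (bonus E p hist) :=
  (((((measurable_quadForm E (empCov E p hist)⁻¹).const_mul _).sqrt).const_mul _).min
    measurable_const).const_mul _

namespace Alg

variable (alg : Alg E Mods Pol p) (P : LinearModel E)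

/-- The policies of the episodes, continued by the first one after the end of the run. -/
noncomputable def policySeq (hN : 0 < p.N) (hist : Fin p.N → Batch S A p) (k : ℕ) : Policy S A :=
  if h : k < p.N then alg.iterate hist ⟨k, h⟩ else alg.iterate hist ⟨0, hN⟩

theorem policySeq_of_lt (hN : 0 < p.N) (hist : Fin p.N → Batch S A p) {k : ℕ} (h : k < p.N) :
    alg.policySeq hN hist k = alg.policy k (prefixHist h.le hist) := dif_pos h

theorem integral_coverLaw (hN : 0 < p.N) (hist : Fin p.N → Batch S A p) {n : ℕ} (hn : n < p.N)
    {f : S × A → ℝ} (hf : Measurable f) {B : ℝ} (hB : ∀ x, |f x| ≤ B) :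
    ∑ i ∈ Finset.range (n + 1), ∫ x, f x ∂visitLaw E P.kernel (alg.policySeq hN hist i) =
      (n + 1 : ℕ) * ∫ x, f x ∂alg.coverLaw P n (prefixHist hn.le hist) := by
  have h0 : ((n + 1 : ℕ) : ℝ) ≠ 0 := by positivity
  rw [coverLaw, integral_smul_measure, integral_finsetSum_measure fun h _ =>
    integrable_of_abs_le hf B hB, Finset.sum_range]
  simp only [ENNReal.toReal_inv, ENNReal.toReal_natCast, smul_eq_mul]
  rw [mul_inv_cancel_left₀ h0]
  refine Finset.sum_congr rfl fun i _ => ?_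
  rw [alg.policySeq_of_lt hN hist (by omega : (i : ℕ) < p.N)]
  rfl

variable {alg P}

/-- At most `N` episodes enter the sum, each deviating by at most `1/(2N)`; the ridge parts cancel
because both equal the identity. -/
theorem abs_empCov_sub_popCov_le (hlam : p.lam = 1) (hN : 0 < p.N) (hK : 0 < p.K)
    {hist : Fin p.N → Batch S A p} {τ : ℝ}
    (hgood : hist ∈ alg.goodRun P (1 / (2 * p.N)) τ) {n : ℕ} (hn : n < p.N) (v : Fin d → ℝ) :
    |v ⬝ᵥ (empCov E p (prefixHist (Nat.succ_le_of_lt hn) hist) *ᵥ v) -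
      v ⬝ᵥ (popCov E (fun k => visitLaw E P.kernel (alg.policySeq hN hist k)) n *ᵥ v)| ≤
      1 / 2 * (v ⬝ᵥ v) := by
  have hN' : (0 : ℝ) < p.N := by exact_mod_cast hN
  have hv : 0 ≤ v ⬝ᵥ v := Finset.sum_nonneg fun i _ => mul_self_nonneg _
  rw [quadForm_empCov hlam, quadForm_popCov, Finset.sum_range, add_sub_add_left_eq_sub,
    ← Finset.sum_sub_distrib]
  refine (Finset.abs_sum_le_sum_abs _ _).trans ?_
  have h1 : ∀ i ∈ (Finset.univ : Finset (Fin (n + 1))),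
      |(p.K : ℝ)⁻¹ * ∑ j, ((E.φ ((prefixHist (Nat.succ_le_of_lt hn) hist i).1 j)).ofLp ⬝ᵥ v) ^ 2 -
        ∫ x, ((E.φ x).ofLp ⬝ᵥ v) ^ 2 ∂visitLaw E P.kernel (alg.policySeq hN hist i)| ≤
      1 / (2 * p.N) * (v ⬝ᵥ v) := by
    intro i _
    have hi : (i : ℕ) < p.N := by omega
    refine quadForm_deviation_le E _ hK ?_ v
    rw [alg.policySeq_of_lt hN hist hi]
    have := (hgood ⟨i, hi⟩).1
    exact (not_le.1 this).le
  refine (Finset.sum_le_sum h1).trans ?_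
  rw [Finset.sum_const, Finset.card_univ, Fintype.card_fin, nsmul_eq_mul, ← mul_assoc]
  refine mul_le_mul_of_nonneg_right ?_ hv
  have : ((n + 1 : ℕ) : ℝ) ≤ p.N := by exact_mod_cast hn
  rw [mul_one_div, div_le_div_iff₀ (by positivity) (by norm_num)]
  linarith

/-- The policy of episode `n + 1` is planned with the model and the bonus of episode `n`, so the
width uses the covariance up to `n`. -/
theorem gap_le_of_goodRun (hPM : P ∈ Mods) (hc : p.c = (E.H : ℝ) * √((d : ℝ) + 1))
    (hlam : p.lam = 1) (hN : 0 < p.N) (hK : 0 < p.K) {hist : Fin p.N → Batch S A p}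
    (hgood : hist ∈ alg.goodRun P (1 / (2 * p.N)) (1 / (2 * p.N))) {pol : Policy S A}
    (hpol : pol ∈ Pol) {n : ℕ} (hn : n + 1 < p.N) :
    J E pol E.r P.kernel - J E (alg.policySeq hN hist (n + 1)) E.r P.kernel ≤
      3 * (E.H : ℝ) ^ 3 * ∫ x, width E (popCov E
        (fun k => visitLaw E P.kernel (alg.policySeq hN hist k)) n) x
        ∂visitLaw E P.kernel (alg.policySeq hN hist (n + 1)) := by
  have hn' : n < p.N := by omega
  have hN' : (0 : ℝ) < p.N := by exact_mod_cast hN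
  set ρ : ℕ → Measure (S × A) := fun k => visitLaw E P.kernel (alg.policySeq hN hist k)
  set hist' := prefixHist (Nat.succ_le_of_lt hn') hist
  have hQ := alg.mle_mem n hn' hist'
  set Q := alg.mle n hist'
  have hacc : ∑ i ∈ Finset.range (n + 1), ∫ x, (1 - P.affinity Q x) ∂ρ i ≤ 1 / 2 := by
    have h1 : 1 - ∫ x, P.affinity Q x ∂alg.coverLaw P n (prefixHist hn'.le hist) <
        1 / (2 * p.N) := by
      by_contra h
      -- The true model lies in the class, so the maximizer is at least as likely; if it were also
      -- inaccurate, the run would be bad.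
      exact (hgood ⟨n, hn'⟩).2 Q hQ ⟨not_lt.1 h, alg.mle_max n hn' hist' P hPM⟩
    have ha : ∀ x, |P.affinity Q x| ≤ 1 := fun x => by
      rw [abs_of_nonneg (P.affinity_nonneg Q x)]; exact P.affinity_le_one Q x
    have ha' : ∀ x, |1 - P.affinity Q x| ≤ 1 := fun x => by
      rw [abs_le]
      constructor <;> linarith [P.affinity_nonneg Q x, P.affinity_le_one Q x]
    rw [alg.integral_coverLaw P hN hist hn' ((P.measurable_affinity Q).const_sub 1) ha',
      integral_sub (integrable_const _) (integrable_of_abs_le (P.measurable_affinity Q) 1 ha)]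
    simp only [integral_const, probReal_univ, one_smul]
    have h2 : ((n + 1 : ℕ) : ℝ) ≤ p.N := by exact_mod_cast hn'
    calc _ ≤ ((n + 1 : ℕ) : ℝ) * (1 / (2 * p.N)) :=
          mul_le_mul_of_nonneg_left h1.le (Nat.cast_nonneg _)
      _ ≤ p.N * (1 / (2 * p.N)) := mul_le_mul_of_nonneg_right h2 (by positivity)
      _ = 1 / 2 := by field_simp
  have hw := width_le_and_le_width (E := E) (popCov_posDef (ρ := ρ) n) (le_quadForm_popCov n)
    (empCov_isHermitian hist') (abs_empCov_sub_popCov_le hlam hN hK hgood hn')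
  have hH : (0 : ℝ) ≤ E.H := Nat.cast_nonneg _
  refine J_sub_J_le_integral_width P Q pol (alg.policySeq hN hist (n + 1))
    (measurable_bonus E hist') (measurable_width E _) (width_nonneg _) (width_le_one _)
    (fun x => ?_) (fun x => ?_)
    (fun V B hV hB hV0 hVB x => abs_modelError_le_width P Q n hacc hV hV0 hVB hB x) ?_
  · rw [bonus_eq hc]
    nlinarith [mul_le_mul_of_nonneg_left (hw x).1 hH]
  · rw [bonus_eq hc]
    exact mul_le_mul_of_nonneg_left (hw x).2 (by positivity)
  · rw [alg.policySeq_of_lt hN hist hn]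
    exact alg.plan_max n hn' hist' pol hpol

/-- The first policy is arbitrary and costs at most `H`; the widths bound the remaining `N - 1`
episodes. -/
theorem sum_gap_le_of_goodRun (hPM : P ∈ Mods) (hc : p.c = (E.H : ℝ) * √((d : ℝ) + 1))
    (hlam : p.lam = 1) (hN : 0 < p.N) (hK : 0 < p.K) {hist : Fin p.N → Batch S A p}
    (hgood : hist ∈ alg.goodRun P (1 / (2 * p.N)) (1 / (2 * p.N))) {pol : Policy S A}
    (hpol : pol ∈ Pol) :
    ∑ i, (J E pol E.r P.kernel - J E (alg.iterate hist i) E.r P.kernel) ≤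
      E.H + 3 * (E.H : ℝ) ^ 3 * √(p.N * ((d + 1) * (2 * (d * Real.log (p.N + 1))))) := by
  set ρ : ℕ → Measure (S × A) := fun k => visitLaw E P.kernel (alg.policySeq hN hist k)
  obtain ⟨m, hm⟩ : ∃ m, p.N = m + 1 := ⟨p.N - 1, by omega⟩
  have h1 : ∑ i, (J E pol E.r P.kernel - J E (alg.iterate hist i) E.r P.kernel) =
      ∑ k ∈ Finset.range (m + 1),
        (J E pol E.r P.kernel - J E (alg.policySeq hN hist k) E.r P.kernel) := by
    rw [← hm, Finset.sum_range]
    exact Finset.sum_congr rfl fun i _ => by rw [alg.policySeq_of_lt hN hist i.2]; rfl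
  rw [h1, Finset.sum_range_succ', add_comm]
  refine add_le_add ?_ ?_
  · linarith [(J_mem_Icc (E := E) P.kernel pol).2,
      (J_mem_Icc (E := E) P.kernel (alg.policySeq hN hist 0)).1]
  · have h2 := Finset.sum_le_sum fun k (hk : k ∈ Finset.range m) =>
      gap_le_of_goodRun (alg := alg) hPM hc hlam hN hK hgood hpol
        (n := k) (by have := Finset.mem_range.1 hk; omega)
    refine h2.trans ?_
    rw [← Finset.mul_sum]
    refine mul_le_mul_of_nonneg_left (Real.le_sqrt_of_sq_le ?_) (by positivity)
    refine (sum_integral_width_le (E := E) (ρ := ρ) m).trans ?_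
    have h3 : (m : ℝ) + 2 = p.N + 1 := by rw [hm]; push_cast; ring
    have h4 : (m : ℝ) ≤ p.N := by rw [hm]; push_cast; linarith
    rw [h3]
    refine mul_le_mul_of_nonneg_right h4 ?_
    have : 0 ≤ Real.log ((p.N : ℝ) + 1) :=
      Real.log_nonneg (by linarith [(Nat.cast_nonneg p.N : (0 : ℝ) ≤ p.N)])
    positivity

/-- The single iterate is the one of largest true value. It is chosen before the competitor `pol`
and is at least the average. -/
theorem value_guarantee_of_goodRun (hPM : P ∈ Mods) (hc : p.c = (E.H : ℝ) * √((d : ℝ) + 1))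
    (hlam : p.lam = 1) (hN : 0 < p.N) (hK : 0 < p.K) {hist : Fin p.N → Batch S A p}
    (hgood : hist ∈ alg.goodRun P (1 / (2 * p.N)) (1 / (2 * p.N))) {ε : ℝ}
    (hε : E.H + 3 * (E.H : ℝ) ^ 3 * √(p.N * ((d + 1) * (2 * (d * Real.log (p.N + 1))))) ≤
      p.N * ε) :
    (∀ pol ∈ Pol, J E pol E.r P.kernel - ε ≤ alg.returnValue P hist) ∧
      ∃ i, ∀ pol ∈ Pol, J E pol E.r P.kernel - ε ≤ J E (alg.iterate hist i) E.r P.kernel := by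
  have hN' : (0 : ℝ) < p.N := by exact_mod_cast hN
  have h1 : ∀ pol ∈ Pol, J E pol E.r P.kernel - ε ≤ alg.returnValue P hist := by
    intro pol hpol
    have h := (sum_gap_le_of_goodRun hPM hc hlam hN hK hgood hpol).trans hε
    rw [Finset.sum_sub_distrib, Finset.sum_const, Finset.card_univ, Fintype.card_fin,
      nsmul_eq_mul] at h
    rw [returnValue, le_inv_mul_iff₀ hN']
    linarith
  refine ⟨h1, ?_⟩
  have : Nonempty (Fin p.N) := ⟨⟨0, hN⟩⟩
  obtain ⟨i, hi⟩ := Finite.exists_max fun i => J E (alg.iterate hist i) E.r P.kernel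
  refine ⟨i, fun pol hpol => (h1 pol hpol).trans ?_⟩
  rw [returnValue, inv_mul_le_iff₀ hN']
  simpa using Finset.sum_le_sum fun j (_ : j ∈ Finset.univ) => hi j

end Alg

end GoodRun

/-! ### Numerical consequences of the choice of parameters. -/

section Arithmetic

theorem three_le_log {a : ℝ} (ha : 40 ≤ a) : 3 ≤ Real.log a := by
  rw [Real.le_log_iff_exp_le (by linarith), show (3 : ℝ) = (3 : ℕ) * 1 by norm_num, Real.exp_nat_mul]
  calc Real.exp 1 ^ 3 ≤ 2.72 ^ 3 :=
        pow_le_pow_left₀ (Real.exp_pos 1).le (by linarith [Real.exp_one_lt_d9]) 3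
    _ ≤ a := by norm_num; linarith

/-- It suffices that `n + 1 ≤ a²`, which follows from `log a ≤ a/3 + 1` once `a ≥ 40`. -/
theorem log_episodes_le {a n : ℝ} (ha : 40 ≤ a) (hn0 : 0 ≤ n) (hn : n ≤ 2 * a * Real.log a + 1) :
    Real.log (n + 1) ≤ 2 * Real.log a := by
  have h1 : Real.log a ≤ a / 3 + 1 := by
    have h3 := Real.log_le_sub_one_of_pos (show (0 : ℝ) < 3 by norm_num)
    have h4 := Real.log_le_sub_one_of_pos (show 0 < a / 3 by linarith)
    rw [Real.log_div (by linarith) (by norm_num)] at h4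
    linarith
  rw [show 2 * Real.log a = Real.log (a ^ 2) by rw [Real.log_pow]; norm_num]
  refine Real.log_le_log (by linarith) ?_
  nlinarith

/-- The budget `n ε` is split: the cost `h` of the first episode takes at most a twentieth, and the
root takes `19/20`, since its square is at most `9/10 · (n ε)²` and `9/10 < (19/20)²`. -/
theorem regret_le_of_episodes {h d ε n : ℝ} (hh : 1 ≤ h) (hd : 1 ≤ d) (hε0 : 0 < ε) (hε1 : ε < 1)
    (hn : 80 * h ^ 6 * d ^ 2 / ε ^ 2 * Real.log (40 * h ^ 6 * d ^ 2 / ε ^ 2) ≤ n)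
    (hlog : Real.log (n + 1) ≤ 2 * Real.log (40 * h ^ 6 * d ^ 2 / ε ^ 2))
    (hl : 3 ≤ Real.log (40 * h ^ 6 * d ^ 2 / ε ^ 2)) :
    h + 3 * h ^ 3 * √(n * ((d + 1) * (2 * (d * Real.log (n + 1))))) ≤ n * ε := by
  set l := Real.log (40 * h ^ 6 * d ^ 2 / ε ^ 2)
  have hn' : 80 * h ^ 6 * d ^ 2 * l ≤ n * ε ^ 2 := by
    rwa [div_mul_eq_mul_div, div_le_iff₀ (by positivity)] at hn
  have hn0 : 0 ≤ n := le_trans (by positivity) hn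
  have hh6 : h ≤ h ^ 6 := le_self_pow₀ hh (by norm_num)
  have hd2 : 1 ≤ d ^ 2 := one_le_pow₀ hd
  have hlow : 240 * h ≤ n * ε := by
    have h1 : 240 * h ≤ 80 * h ^ 6 * d ^ 2 * l := by
      have h2 : h * 1 ≤ h ^ 6 * d ^ 2 := mul_le_mul hh6 hd2 (by norm_num) (by positivity)
      have h3 : h * 1 * 3 ≤ h ^ 6 * d ^ 2 * l := mul_le_mul h2 hl (by norm_num) (by positivity)
      linarith
    nlinarith [mul_nonneg hn0 hε0.le]
  have hsq : 3 * h ^ 3 * √(n * ((d + 1) * (2 * (d * Real.log (n + 1))))) ≤ 19 / 20 * (n * ε) := by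
    rw [show 3 * h ^ 3 = √((3 * h ^ 3) ^ 2) from (Real.sqrt_sq (by positivity)).symm,
      ← Real.sqrt_mul (by positivity)]
    refine Real.sqrt_le_iff.2 ⟨by positivity, ?_⟩
    have h1 : (d + 1) * (2 * (d * Real.log (n + 1))) ≤ 8 * d ^ 2 * l := by
      have h2 : (d + 1) * (2 * d) ≤ 4 * d ^ 2 := by nlinarith
      have h3 : 0 ≤ (d + 1) * (2 * d) := by positivity
      calc (d + 1) * (2 * (d * Real.log (n + 1))) = (d + 1) * (2 * d) * Real.log (n + 1) := by ring
        _ ≤ (d + 1) * (2 * d) * (2 * l) := mul_le_mul_of_nonneg_left hlog h3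
        _ ≤ 4 * d ^ 2 * (2 * l) := mul_le_mul_of_nonneg_right h2 (by linarith)
        _ = _ := by ring
    calc (3 * h ^ 3) ^ 2 * (n * ((d + 1) * (2 * (d * Real.log (n + 1)))))
        ≤ (3 * h ^ 3) ^ 2 * (n * (8 * d ^ 2 * l)) := by gcongr
      _ = 9 / 10 * n * (80 * h ^ 6 * d ^ 2 * l) := by ring
      _ ≤ 9 / 10 * n * (n * ε ^ 2) := by gcongr
      _ ≤ (19 / 20 * (n * ε)) ^ 2 := by nlinarith [sq_nonneg (n * ε)]
  linarith

theorem failure_le {δ d C n k m : ℝ} (hδ0 : 0 < δ) (hd : 1 ≤ d) (hC : 1 ≤ C) (hn : 0 < n)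
    (hk : 32 * n ^ 2 * Real.log (8 * n * d / δ) ≤ k) (hm : 2 * n * Real.log (C * n / δ) ≤ m) :
    n * (2 * Real.exp (-(k * (1 / (2 * n)) ^ 2 / 8)) + C * Real.exp (-(m * (1 / (2 * n))))) ≤
      2 * δ := by
  have h1 : Real.exp (-(k * (1 / (2 * n)) ^ 2 / 8)) ≤ δ / (8 * n * d) := by
    have h0 : 0 < 8 * n * d / δ := by positivity
    rw [show δ / (8 * n * d) = (8 * n * d / δ)⁻¹ by rw [inv_div], ← Real.exp_log (inv_pos.2 h0),
      Real.log_inv, Real.exp_le_exp, neg_le_neg_iff,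
      show k * (1 / (2 * n)) ^ 2 / 8 = k / (32 * n ^ 2) by field_simp; ring,
      le_div_iff₀ (by positivity)]
    linarith
  have h2 : Real.exp (-(m * (1 / (2 * n)))) ≤ δ / (C * n) := by
    have h0 : 0 < C * n / δ := by positivity
    rw [show δ / (C * n) = (C * n / δ)⁻¹ by rw [inv_div], ← Real.exp_log (inv_pos.2 h0),
      Real.log_inv, Real.exp_le_exp, neg_le_neg_iff, mul_one_div, le_div_iff₀ (by positivity)]
    linarith
  calc _ ≤ n * (2 * (δ / (8 * n * d)) + C * (δ / (C * n))) := by gcongr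
    _ = δ / (4 * d) + δ := by field_simp; ring
    _ ≤ δ + δ := by
        gcongr
        exact div_le_self hδ0.le (by linarith)
    _ = _ := by ring

theorem samples_le {δ d C n k m T : ℝ} (hδ0 : 0 < δ) (hδ1 : δ < 1 / 2) (hd : 1 ≤ d) (hC : 1 ≤ C)
    (hT : 240 * d ^ 2 ≤ T) (hnT : T ≤ n) (hn : n ≤ T + 1)
    (hk : k ≤ 32 * n ^ 2 * Real.log (8 * n * d / δ) + 1)
    (hm : m ≤ 2 * n * Real.log (C * n / δ) + 1) :
    n * (k + m) ≤ 60 * T ^ 3 * Real.log (8 * T * C / δ) := by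
  have hd2 : 1 ≤ d ^ 2 := one_le_pow₀ hd
  have hT0 : 240 ≤ T := by linarith
  have hn0 : 0 < n := by linarith
  have hTp : 0 < T := by linarith
  set L := Real.log (8 * T * C / δ) with hL
  have hL1 : 1 ≤ L := by
    refine le_trans (by norm_num) (three_le_log (a := 8 * T * C / δ) ?_)
    rw [le_div_iff₀ hδ0]
    nlinarith
  have h1 : Real.log (8 * n * d / δ) ≤ 3 / 2 * L := by
    -- Comparing a square with a cube: the extra power of `T` on the right pays for `d²`, and `δ³ ≤
    -- δ²`. The factor `3/2` turns 32 into 48.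
    have h2 : 2 * Real.log (8 * n * d / δ) ≤ 3 * L := by
      have e1 : 2 * Real.log (8 * n * d / δ) = Real.log ((8 * n * d / δ) ^ 2) := by
        rw [Real.log_pow]; norm_num
      have e2 : 3 * L = Real.log ((8 * T * C / δ) ^ 3) := by
        rw [Real.log_pow, ← hL]; norm_num
      rw [e1, e2]
      refine Real.log_le_log (by positivity) ?_
      have h3 : (8 * n * d) ^ 2 ≤ (8 * T * C) ^ 3 := by
        have hn2 : n ^ 2 ≤ 2 * T ^ 2 := by nlinarith
        have hC3 : 1 ≤ C ^ 3 := one_le_pow₀ hC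
        calc (8 * n * d) ^ 2 = 64 * n ^ 2 * d ^ 2 := by ring
          _ ≤ 64 * (2 * T ^ 2) * T := by gcongr; linarith
          _ ≤ 512 * T ^ 3 * 1 := by nlinarith [pow_pos hTp 3]
          _ ≤ 512 * T ^ 3 * C ^ 3 := by gcongr
          _ = _ := by ring
      rw [div_pow, div_pow]
      refine div_le_div₀ (by positivity) h3 (by positivity) ?_
      exact pow_le_pow_of_le_one hδ0.le (by linarith) (by norm_num)
    linarith
  have h2 : Real.log (C * n / δ) ≤ L := by
    refine Real.log_le_log (by positivity) (div_le_div_of_nonneg_right ?_ hδ0.le)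
    nlinarith
  have hk' : k ≤ 48 * n ^ 2 * L + 1 := by
    have := mul_le_mul_of_nonneg_left h1 (show 0 ≤ 32 * n ^ 2 by positivity)
    linarith
  have hm' : m ≤ 2 * n * L + 1 := by
    have := mul_le_mul_of_nonneg_left h2 (show 0 ≤ 2 * n by positivity)
    linarith
  -- One further unit of `n² L` absorbs the model-learning samples and both ceilings, because `n ≥
  -- 240`.
  have hkm : k + m ≤ 49 * n ^ 2 * L := by
    have h3 : 240 * n ≤ n ^ 2 := by nlinarith
    have h4 : 240 * n * L ≤ n ^ 2 * L := mul_le_mul_of_nonneg_right h3 (by linarith)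
    have h5 : n * 1 ≤ n * L := mul_le_mul_of_nonneg_left hL1 hn0.le
    nlinarith
  -- The ceiling changes `T` by a factor of at most `241/240`, whose cube is below `60/49`.
  have hn3 : n ^ 3 ≤ 60 / 49 * T ^ 3 := by
    have h3 : n ≤ 241 / 240 * T := by linarith
    calc n ^ 3 ≤ (241 / 240 * T) ^ 3 := pow_le_pow_left₀ hn0.le h3 3
      _ = (241 / 240) ^ 3 * T ^ 3 := by ring
      _ ≤ _ := by gcongr; norm_num
  calc n * (k + m) ≤ n * (49 * n ^ 2 * L) := by gcongr
    _ = 49 * n ^ 3 * L := by ring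
    _ ≤ 49 * (60 / 49 * T ^ 3) * L := by gcongr
    _ = _ := by ring

end Arithmetic

end PCMLP

/-! ### Assembly of the probability bound and the sample count. -/

theorem mainTheorem1 {S A : Type*} [MeasurableSpace S] [MeasurableSpace A] {d : ℕ} (hd : 1 ≤ d)
    (E : PCMLP.Env S A d)
    (Mods : Finset (PCMLP.LinearModel E)) (Pstar : PCMLP.LinearModel E) (hPstar : Pstar ∈ Mods)
    (Pol : Set (PCMLP.Policy S A))
    (δ ε : ℝ) (hδ : δ ∈ Set.Ioo (0 : ℝ) (1 / 2)) (hε : ε ∈ Set.Ioo (0 : ℝ) 1)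
    (p : PCMLP.HyperParams)
    (hN : p.N = ⌈80 * (E.H : ℝ) ^ 6 * (d : ℝ) ^ 2 / ε ^ 2
      * Real.log (40 * (E.H : ℝ) ^ 6 * (d : ℝ) ^ 2 / ε ^ 2)⌉₊)
    (hM : p.M = ⌈2 * (p.N : ℝ) * Real.log ((Mods.card : ℝ) * p.N / δ)⌉₊)
    (hc : p.c = (E.H : ℝ) * √((d : ℝ) + 1))
    (hK : p.K = ⌈32 * (p.N : ℝ) ^ 2 * Real.log (8 * p.N * d / δ)⌉₊)
    (hlam : p.lam = 1)
    (alg : PCMLP.Alg E Mods Pol p) :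
    ENNReal.ofReal (1 - 2 * δ) ≤ alg.runLaw Pstar p.N
        {hist | (∀ pol ∈ Pol,
            PCMLP.J E pol E.r Pstar.kernel - ε ≤ alg.returnValue Pstar hist) ∧
          ∃ i, ∀ pol ∈ Pol, PCMLP.J E pol E.r Pstar.kernel - ε
            ≤ PCMLP.J E (alg.iterate hist i) E.r Pstar.kernel}
    ∧ (p.numSamples : ℝ) ≤ 60 * 80 ^ 3 * ((E.H : ℝ) ^ 18 * (d : ℝ) ^ 6 / ε ^ 6)
        * Real.log (640 * (E.H : ℝ) ^ 6 * (d : ℝ) ^ 2 * Mods.card / (ε ^ 2 * δ)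
            * Real.log (40 * (E.H : ℝ) ^ 6 * (d : ℝ) ^ 2 / ε ^ 2))
        * Real.log (40 * (E.H : ℝ) ^ 6 * (d : ℝ) ^ 2 / ε ^ 2) ^ 3 := by
  obtain ⟨hδ0, hδ1⟩ := hδ
  obtain ⟨hε0, hε1⟩ := hε
  have hH1 : (1 : ℝ) ≤ E.H := by exact_mod_cast E.H_pos
  have hd1 : (1 : ℝ) ≤ d := by exact_mod_cast hd
  have hC1 : (1 : ℝ) ≤ Mods.card := by exact_mod_cast Finset.card_pos.2 ⟨_, hPstar⟩
  have hA0 : 40 * (d : ℝ) ^ 2 ≤ 40 * (E.H : ℝ) ^ 6 * (d : ℝ) ^ 2 / ε ^ 2 := by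
    have h1 : (1 : ℝ) ≤ (E.H : ℝ) ^ 6 := one_le_pow₀ hH1
    have h2 : ε ^ 2 ≤ 1 := pow_le_one₀ hε0.le hε1.le
    rw [le_div_iff₀ (by positivity)]
    calc 40 * (d : ℝ) ^ 2 * ε ^ 2 ≤ 40 * (d : ℝ) ^ 2 * 1 := by gcongr
      _ ≤ 40 * (d : ℝ) ^ 2 * (E.H : ℝ) ^ 6 := by gcongr
      _ = _ := by ring
  have hd2 : (1 : ℝ) ≤ (d : ℝ) ^ 2 := one_le_pow₀ hd1
  have hA : 40 ≤ 40 * (E.H : ℝ) ^ 6 * (d : ℝ) ^ 2 / ε ^ 2 := by linarith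
  have hl := PCMLP.three_le_log hA
  have hnlow := (Nat.le_ceil _).trans_eq (congrArg (Nat.cast (R := ℝ)) hN.symm)
  have hklow := (Nat.le_ceil _).trans_eq (congrArg (Nat.cast (R := ℝ)) hK.symm)
  have hmlow := (Nat.le_ceil _).trans_eq (congrArg (Nat.cast (R := ℝ)) hM.symm)
  have hlogN : 0 < Real.log (8 * p.N * d / δ) → 0 < p.N → 0 < p.K := fun h1 h2 => by
    have h3 : (0 : ℝ) < p.N := by exact_mod_cast h2
    have h4 : (0 : ℝ) < p.K := lt_of_lt_of_le (by positivity) hklow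
    exact_mod_cast h4
  -- With `a` the argument of the logarithm, `N` is the ceiling of `2 a log a`; here `a ≥ 40 d²` and
  -- `log a ≥ 3`.
  have hT240 : 240 * (d : ℝ) ^ 2 ≤ 80 * (E.H : ℝ) ^ 6 * (d : ℝ) ^ 2 / ε ^ 2
      * Real.log (40 * (E.H : ℝ) ^ 6 * (d : ℝ) ^ 2 / ε ^ 2) := by
    rw [show 80 * (E.H : ℝ) ^ 6 * (d : ℝ) ^ 2 / ε ^ 2 =
      2 * (40 * (E.H : ℝ) ^ 6 * (d : ℝ) ^ 2 / ε ^ 2) by ring]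
    nlinarith
  have hnpos : (0 : ℝ) < p.N := by linarith
  have hNpos : 0 < p.N := by exact_mod_cast hnpos
  have hceil : ∀ {x : ℝ}, 0 ≤ x → ((⌈x⌉₊ : ℕ) : ℝ) ≤ x + 1 := fun hx => (Nat.ceil_lt_add_one hx).le
  have hn1 : (1 : ℝ) ≤ p.N := by exact_mod_cast hNpos
  have hlk : 0 < Real.log (8 * p.N * d / δ) := by
    refine Real.log_pos ((lt_div_iff₀ hδ0).2 ?_)
    nlinarith
  have hlm : 0 ≤ Real.log ((Mods.card : ℝ) * p.N / δ) := by
    refine Real.log_nonneg ((le_div_iff₀ hδ0).2 ?_)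
    nlinarith
  have hnup := hN ▸ hceil (x := 80 * (E.H : ℝ) ^ 6 * (d : ℝ) ^ 2 / ε ^ 2
      * Real.log (40 * (E.H : ℝ) ^ 6 * (d : ℝ) ^ 2 / ε ^ 2)) (by linarith)
  have hkup : (p.K : ℝ) ≤ 32 * (p.N : ℝ) ^ 2 * Real.log (8 * p.N * d / δ) + 1 := by
    rw [hK]; exact hceil (by positivity)
  have hmup : (p.M : ℝ) ≤ 2 * (p.N : ℝ) * Real.log ((Mods.card : ℝ) * p.N / δ) + 1 := by
    rw [hM]; exact hceil (by positivity)
  have hlog := PCMLP.log_episodes_le hA hnpos.le (hnup.trans_eq (by ring))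
  have hreg := PCMLP.regret_le_of_episodes hH1 hd1 hε0 hε1 hnlow hlog hl
  refine ⟨?_, ?_⟩
  · have hbad := alg.runLaw_goodRun_compl_le Pstar (t := 1 / (2 * p.N)) (τ := 1 / (2 * p.N))
      (by positivity)
    have hfail := PCMLP.failure_le hδ0 hd1 hC1 hnpos hklow hmlow
    have h1 := hbad.trans (ENNReal.ofReal_le_ofReal hfail)
    have hsub : alg.goodRun Pstar (1 / (2 * p.N)) (1 / (2 * p.N)) ⊆ _ := fun hist hgood =>
      PCMLP.Alg.value_guarantee_of_goodRun hPstar hc hlam hNpos (hlogN hlk hNpos) hgood hreg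
    refine le_trans ?_ (MeasureTheory.measure_mono hsub)
    rw [ENNReal.ofReal_sub _ (by linarith), ENNReal.ofReal_one]
    -- Subadditivity on the good set and its complement is enough, so no measurability of the good
    -- set or of the target event is used.
    refine tsub_le_iff_right.2 ?_
    calc (1 : ENNReal) = alg.runLaw Pstar p.N Set.univ := by simp
      _ ≤ alg.runLaw Pstar p.N (alg.goodRun Pstar (1 / (2 * p.N)) (1 / (2 * p.N))) +
          alg.runLaw Pstar p.N (alg.goodRun Pstar (1 / (2 * p.N)) (1 / (2 * p.N)))ᶜ := by
        rw [← Set.union_compl_self (alg.goodRun Pstar (1 / (2 * p.N)) (1 / (2 * p.N)))]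
        exact MeasureTheory.measure_union_le _ _
      _ ≤ _ := by gcongr
  · have h := PCMLP.samples_le hδ0 hδ1 hd1 hC1 hT240 hnlow hnup hkup hmup
    rw [PCMLP.HyperParams.numSamples]
    push_cast
    refine h.trans_eq ?_
    have e1 : 8 * (80 * (E.H : ℝ) ^ 6 * (d : ℝ) ^ 2 / ε ^ 2
        * Real.log (40 * (E.H : ℝ) ^ 6 * (d : ℝ) ^ 2 / ε ^ 2)) * Mods.card / δ =
        640 * (E.H : ℝ) ^ 6 * (d : ℝ) ^ 2 * Mods.card / (ε ^ 2 * δ)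
            * Real.log (40 * (E.H : ℝ) ^ 6 * (d : ℝ) ^ 2 / ε ^ 2) := by
      field_simp; ring
    rw [e1]
    ring
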